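/- Let $X$ be a scheme. Let $(\mathcal V,q)$ be a twisted orthogonal bundle on $X$: a vector bundle $\mathcal V$ of constant rank with a quadratic form $q$ with values in a line bundle $L$ (a global section of $S^2(\mathcal V^*)\otimes L$) such that the associated symmetric bilinear form $b(v,w)=q(v+w)-q(v)-q(w)$ is a perfect pairing, i.e. induces an isomorphism $\beta:\mathcal V\to\mathcal V^*(L):=\mathcal V^*\otimes L=\mathcal{H}om(\mathcal V,L)$. Residue fields are arbitrary; in particular characteristic $2$ is allowed. Let $f:\mathcal E\hookrightarrow\mathcal V$ and $g:\mathcal F\hookrightarrow\mathcal V$ be Lagrangian subbundles: $\operatorname{rk}\mathcal V=2n$ is even, and $\mathcal E,\mathcal F$ are subbundles of rank $n$ (with locally free quotients) on which $q$ vanishes identically. Let $$\lambda:\ \mathcal E\xrightarrow{\ f\ }\mathcal V\xrightarrow{\ \beta\ }\mathcal V^*(L)\xrightarrow{\ g^*\ }\mathcal F^*(L).$$ For $x\in X$ write $k(x)$ for the residue field, $\mathcal V(x)$ for the fiber, $\mathcal E(x)\cap\mathcal F(x)$ for the intersection inside $\mathcal V(x)$, and $\lambda(x):\mathcal E(x)\to\mathcal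 F^*(L)(x)$ for the induced map of fibers. The following are equivalent: (a) The rank of $\lambda(x)$ is even for every $x\in X$. (b) $\dim_{k(x)}\bigl[\mathcal E(x)\cap\mathcal F(x)\bigr]\equiv\operatorname{rk}(\mathcal E)\pmod 2$ for all $x\in X$. (c) $\lambda$ is locally alternating: there exist a cover of $X$ by open subsets $U$ and isomorphisms $\iota_U:\mathcal F|_U\cong\mathcal E|_U$ such that each composition $\zeta_U=\lambda|_U\circ\iota_U:\mathcal F|_U\to\mathcal F^*(L)|_U$ is alternating, i.e. $\zeta_U(s)(s)=0$ for all local sections $s$ of $\mathcal F|_U$. -/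

import Mathlib

open CategoryTheory AlgebraicGeometry TopologicalSpace Opposite
universe u

namespace SheafModules
variable {X : Scheme.{u}}

/-- Restriction of sections of an `𝒪_X`-module from `U` to `W ≤ U`. -/
noncomputable def res (M : X.Modules) {U W : X.Opens} (h : W ≤ U) : Γ(M, U) →+ Γ(M, W) :=
  (M.presheaf.map (homOfLE h).op).hom

/-- Restriction of functions from `U` to `W ≤ U`. -/
noncomputable def resO {U W : X.Opens} (h : W ≤ U) : Γ(X, U) →+* Γ(X, W) :=
  (X.presheaf.map (homOfLE h).op).hom

variable (M : X.Modules)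

lemma resO_resO {U V W : X.Opens} (h : V ≤ U) (h' : W ≤ V) (r : Γ(X, U)) :
    resO h' (resO h r) = resO (h'.trans h) r := by
  change (X.presheaf.map _ ≫ X.presheaf.map _).hom r = _
  rw [← Functor.map_comp]; rfl

lemma res_res {U V W : X.Opens} (h : V ≤ U) (h' : W ≤ V) (s : Γ(M, U)) :
    res M h' (res M h s) = res M (h'.trans h) s := by
  change (M.presheaf.map _ ≫ M.presheaf.map _).hom s = _
  rw [← Functor.map_comp]; rfl

lemma res_self {U : X.Opens} (h : U ≤ U) (s : Γ(M, U)) : res M h s = s := by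
  change (M.presheaf.map (𝟙 (op U))).hom s = _
  rw [M.presheaf.map_id]; rfl

lemma res_smul {U W : X.Opens} (h : W ≤ U) (r : Γ(X, U)) (s : Γ(M, U)) :
    res M h (r • s) = resO h r • res M h s :=
  M.map_smul (homOfLE h) r s

lemma app_res {M N : X.Modules} (φ : M ⟶ N) {U W : X.Opens} (h : W ≤ U) (s : Γ(M, U)) :
    φ.app W (res M h s) = res N h (φ.app U s) := 
  congr($(φ.mapPresheaf.naturality (homOfLE h).op) s)

lemma res_ext {ι : Type*} (U : X.Opens) (V : ι → X.Opens) (hV : ∀ i, V i ≤ U) (hc : U ≤ iSup V)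
    {s t : Γ(M, U)} (h : ∀ i, res M (hV i) s = res M (hV i) t) : s = t :=
  TopCat.Sheaf.eq_of_locally_eq' ⟨M.presheaf, M.isSheaf⟩ V U (fun i => homOfLE (hV i)) hc s t h

lemma res_glue {ι : Type*} (U : X.Opens) (V : ι → X.Opens) (hV : ∀ i, V i ≤ U) (hc : U ≤ iSup V)
    (s : ∀ i, Γ(M, V i))
    (h : ∀ i j, res M (inf_le_left : V i ⊓ V j ≤ V i) (s i) = res M inf_le_right (s j)) :
    ∃ t : Γ(M, U), ∀ i, res M (hV i) t = s i :=
  (TopCat.Sheaf.existsUnique_gluing' ⟨M.presheaf, M.isSheaf⟩ V U (fun i => homOfLE (hV i)) hc s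
    h).exists


/-- The stalk `M_x` is a module over the local ring `𝒪_{X,x}`. -/
noncomputable instance stalkModule (x : X) :
    Module (X.presheaf.stalk x) (TopCat.Presheaf.stalk (C := Ab.{u}) M.presheaf x) :=
  let M' : PresheafOfModules (X.presheaf ⋙ forget₂ CommRingCat RingCat) := M.val
  inferInstanceAs (Module (X.presheaf.stalk x)
    (TopCat.Presheaf.stalk (C := Ab.{u}) (X := X.toTopCat) M'.presheaf x))

lemma germ_smul (x : X) (U : X.Opens) (hx : x ∈ U) (r : Γ(X, U)) (s : Γ(M, U)) :
    M.presheaf.germ U x hx (r • s) = X.presheaf.germ U x hx r • M.presheaf.germ U x hx s :=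
  let M' : PresheafOfModules (X.presheaf ⋙ forget₂ CommRingCat RingCat) := M.val
  PresheafOfModules.germ_smul M' x U hx r s

/-- The `𝒪_{X,x}`-linear map `M_x → N_x` induced by a morphism of `𝒪_X`-modules. -/
noncomputable def stalkMap {M N : X.Modules} (φ : M ⟶ N) (x : X) :
    TopCat.Presheaf.stalk (C := Ab.{u}) M.presheaf x →ₗ[X.presheaf.stalk x]
      TopCat.Presheaf.stalk (C := Ab.{u}) N.presheaf x where
  __ := ((TopCat.Presheaf.stalkFunctor Ab.{u} x).map φ.mapPresheaf).hom
  map_smul' r m := by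
    obtain ⟨U, hU, r, rfl⟩ := TopCat.Presheaf.exists_germ_eq X.presheaf r
    obtain ⟨V, hV, m, rfl⟩ := TopCat.Presheaf.exists_germ_eq M.presheaf m
    have hx : x ∈ U ⊓ V := ⟨hU, hV⟩
    have h1 : X.presheaf.germ U x hU r =
        X.presheaf.germ (U ⊓ V) x hx (resO inf_le_left r) :=
      (TopCat.Presheaf.germ_res_apply X.presheaf (homOfLE inf_le_left) x hx r).symm
    have h2 : M.presheaf.germ V x hV m =
        M.presheaf.germ (U ⊓ V) x hx (res M inf_le_right m) :=
      (TopCat.Presheaf.germ_res_apply M.presheaf (homOfLE inf_le_right) x hx m).symm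
    have key : ∀ (W : X.Opens) (hW : x ∈ W) (t : Γ(M, W)),
        ((TopCat.Presheaf.stalkFunctor Ab.{u} x).map φ.mapPresheaf).hom
          (M.presheaf.germ W x hW t) = N.presheaf.germ W x hW (φ.app W t) :=
      fun W hW t => TopCat.Presheaf.stalkFunctor_map_germ_apply W x hW φ.mapPresheaf t
    rw [h1, h2]
    exact ((congrArg ((TopCat.Presheaf.stalkFunctor Ab.{u} x).map φ.mapPresheaf).hom
        (germ_smul M x (U ⊓ V) hx _ _).symm).trans (key _ hx _)).trans <|
      (congrArg (N.presheaf.germ (U ⊓ V) x hx) (φ.app_smul _ _)).trans <|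
      (germ_smul N x (U ⊓ V) hx _ _).trans
        (congrArg (X.presheaf.germ (U ⊓ V) x hx (resO inf_le_left r) • ·) (key _ hx _).symm)

/-- The fibre `M(x) = k(x) ⊗ M_x` over `𝒪_{X,x}`, a vector space over the residue field `k(x)`. -/
abbrev Fiber (M : X.Modules) (x : X) : Type u :=
  TensorProduct (X.presheaf.stalk x) (IsLocalRing.ResidueField (X.presheaf.stalk x))
    (TopCat.Presheaf.stalk (C := Ab.{u}) M.presheaf x)

/-- The `k(x)`-linear map `φ(x) : M(x) → N(x)` induced by a morphism `φ : M ⟶ N`. -/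
noncomputable def fiberMap {M N : X.Modules} (φ : M ⟶ N) (x : X) :
    Fiber M x →ₗ[IsLocalRing.ResidueField (X.presheaf.stalk x)] Fiber N x :=
  (stalkMap φ x).baseChange _

/-- The rank of `φ` at the point `x`, that is, the rank of the linear map `φ(x)`. -/
noncomputable def rankAt {M N : X.Modules} (φ : M ⟶ N) (x : X) : ℕ :=
  Module.finrank (IsLocalRing.ResidueField (X.presheaf.stalk x)) (LinearMap.range (fiberMap φ x))

variable (F L : X.Modules)

/-- The `𝒪_U`-linear maps `F|_U → L|_U`: families of `𝒪(W)`-linear maps `F(W) → L(W)`, for `W ≤ U`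
open, which commute with restriction. -/
def homSubgroup (U : X.Opens) :
    AddSubgroup (∀ W : {W : X.Opens // W ≤ U}, Γ(F, W.1) →+ Γ(L, W.1)) where
  carrier := {φ |
    (∀ (W : X.Opens) (hW : W ≤ U) (r : Γ(X, W)) (s : Γ(F, W)), φ ⟨W, hW⟩ (r • s) = r • φ ⟨W, hW⟩ s) ∧
    ∀ (W W' : X.Opens) (hW : W ≤ U) (h : W' ≤ W) (s : Γ(F, W)),
      φ ⟨W', h.trans hW⟩ (res F h s) = res L h (φ ⟨W, hW⟩ s)}
  zero_mem' := by simp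
  add_mem' := by
    rintro φ ψ ⟨h1, h2⟩ ⟨h3, h4⟩
    refine ⟨fun W hW r s => ?_, fun W W' hW h s => ?_⟩
    · simp [h1, h3]
    · have e1 := h2 W W' hW h s
      have e2 := h4 W W' hW h s
      simp only [Pi.add_apply, AddMonoidHom.add_apply, map_add]
      rw [← e1, ← e2]
  neg_mem' := by
    rintro φ ⟨h1, h2⟩
    refine ⟨fun W hW r s => ?_, fun W W' hW h s => ?_⟩
    · simp [h1]
    · have e1 := h2 W W' hW h s
      simp only [Pi.neg_apply, AddMonoidHom.neg_apply, map_neg]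
      rw [← e1]

variable {F L}

@[ext]
lemma homSubgroup.ext {U : X.Opens} {φ ψ : homSubgroup F L U}
    (h : ∀ W hW s, φ.1 ⟨W, hW⟩ s = ψ.1 ⟨W, hW⟩ s) : φ = ψ :=
  Subtype.ext (funext fun W => AddMonoidHom.ext fun s => h W.1 W.2 s)

noncomputable instance homModule (U : X.Opens) : Module Γ(X, U) (homSubgroup F L U) where
  smul r φ := ⟨fun W =>
    { toFun := fun s => resO W.2 r • φ.1 W s
      map_zero' := by simp
      map_add' := by simp }, by
    refine ⟨fun W hW a s => ?_, fun W W' hW h s => ?_⟩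
    · simp [φ.2.1, smul_smul, mul_comm]
    · simp [φ.2.2 W W' hW h, res_smul, resO_resO]⟩
  one_smul φ := by
    ext W hW s
    change resO hW 1 • φ.1 ⟨W, hW⟩ s = _
    simp
  mul_smul a b φ := by
    ext W hW s
    change resO hW (a * b) • φ.1 ⟨W, hW⟩ s = resO hW a • resO hW b • φ.1 ⟨W, hW⟩ s
    simp [smul_smul]
  smul_zero a := by
    ext W hW s
    change resO hW a • (0 : Γ(L, W)) = 0
    simp
  smul_add a φ ψ := by
    ext W hW s
    change resO hW a • (φ.1 ⟨W, hW⟩ s + ψ.1 ⟨W, hW⟩ s) =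
      resO hW a • φ.1 ⟨W, hW⟩ s + resO hW a • ψ.1 ⟨W, hW⟩ s
    simp
  add_smul a b φ := by
    ext W hW s
    change resO hW (a + b) • φ.1 ⟨W, hW⟩ s = resO hW a • φ.1 ⟨W, hW⟩ s + resO hW b • φ.1 ⟨W, hW⟩ s
    simp [add_smul]
  zero_smul φ := by
    ext W hW s
    change resO hW 0 • φ.1 ⟨W, hW⟩ s = 0
    simp

lemma homSubgroup.smul_apply {U : X.Opens} (r : Γ(X, U)) (φ : homSubgroup F L U) (W hW s) :
    (r • φ).1 ⟨W, hW⟩ s = resO hW r • φ.1 ⟨W, hW⟩ s := rfl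

/-- Restriction of a linear map `F|_U → L|_U` to `U' ≤ U`. -/
def homRes {U U' : X.Opens} (h : U' ≤ U) : homSubgroup F L U →+ homSubgroup F L U' where
  toFun φ := ⟨fun W => φ.1 ⟨W.1, W.2.trans h⟩, fun W hW => φ.2.1 W (hW.trans h),
    fun W W' hW => φ.2.2 W W' (hW.trans h)⟩
  map_zero' := rfl
  map_add' _ _ := rfl

variable (F L) in
/-- The presheaf of abelian groups `U ↦ Hom(F|_U, L|_U)`. -/
noncomputable def homPresheaf : (X.Opens)ᵒᵖ ⥤ Ab where
  obj U := .of (homSubgroup F L U.unop)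
  map i := AddCommGrpCat.ofHom (homRes i.unop.le)
  map_id _ := rfl
  map_comp _ _ := rfl

noncomputable instance homPresheafModule (U : (X.Opens)ᵒᵖ) :
    Module (X.ringCatSheaf.obj.obj U) ((homPresheaf F L).obj U) :=
  inferInstanceAs (Module Γ(X, U.unop) (homSubgroup F L U.unop))

variable (F L) in
/-- The presheaf of `𝒪_X`-modules `U ↦ Hom(F|_U, L|_U)`. -/
noncomputable def homPresheafOfModules : X.PresheafOfModules :=
  PresheafOfModules.ofPresheaf (homPresheaf F L) (by
    intro U V i r m
    refine homSubgroup.ext fun W hW s => ?_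
    change resO (hW.trans i.unop.le) r • m.1 ⟨W, hW.trans i.unop.le⟩ s =
      resO hW (resO i.unop.le r) • m.1 ⟨W, hW.trans i.unop.le⟩ s
    exact congrArg (· • m.1 ⟨W, hW.trans i.unop.le⟩ s) (resO_resO i.unop.le hW r).symm)

lemma homPresheaf_isSheaf : TopCat.Presheaf.IsSheaf (X := X.toTopCat) (homPresheaf F L) := by
  rw [TopCat.Presheaf.isSheaf_iff_isSheafUniqueGluing]
  intro ι U φ hφ
  let φ' : ∀ i, homSubgroup F L (U i) := φ
  have compat : ∀ i j (W : X.Opens) (hi : W ≤ U i) (hj : W ≤ U j) (s : Γ(F, W)),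
      (φ' i).1 ⟨W, hi⟩ s = (φ' j).1 ⟨W, hj⟩ s := fun i j W hi hj s =>
    congr($(congrArg Subtype.val (hφ i j)) ⟨W, le_inf hi hj⟩ s)
  have cov : ∀ W : X.Opens, W ≤ iSup U → W ≤ ⨆ i, W ⊓ U i := fun W hW => by
    rw [← inf_iSup_eq]; exact le_inf le_rfl hW
  have ex : ∀ (W : X.Opens), W ≤ iSup U → ∀ s : Γ(F, W), ∃ t : Γ(L, W), ∀ i,
      res L (inf_le_left : W ⊓ U i ≤ W) t = (φ' i).1 ⟨W ⊓ U i, inf_le_right⟩ (res F inf_le_left s) := by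
    intro W hW s
    refine res_glue L W (fun i => W ⊓ U i) (fun i => inf_le_left) (cov W hW) _ fun i j => ?_
    rw [← (φ' i).2.2, ← (φ' j).2.2, res_res, res_res]
    exact compat i j _ _ _ _
  have uniq : ∀ (W : X.Opens), W ≤ iSup U → ∀ t t' : Γ(L, W),
      (∀ i, res L (inf_le_left : W ⊓ U i ≤ W) t = res L inf_le_left t') → t = t' :=
    fun W hW t t' h => res_ext L W (fun i => W ⊓ U i) (fun i => inf_le_left) (cov W hW) h
  choose g hg using ex
  refine ⟨⟨fun W =>
    { toFun := g W.1 W.2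
      map_zero' := uniq W.1 W.2 _ _ fun i => by rw [hg]; simp
      map_add' := fun s s' => uniq W.1 W.2 _ _ fun i => by simp only [map_add, hg] }, ?_, ?_⟩,
      ?_, ?_⟩
  · intro W hW r s
    refine uniq W hW _ _ fun i => ?_
    change res L _ (g W hW (r • s)) = res L _ (r • g W hW s)
    rw [hg, res_smul, res_smul, hg, (φ' i).2.1]
  · intro W W' hW h s
    refine uniq W' (h.trans hW) _ _ fun i => ?_
    change res L _ (g W' (h.trans hW) (res F h s)) = res L _ (res L h (g W hW s))
    have h' : W' ⊓ U i ≤ W ⊓ U i := inf_le_inf_right _ h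
    rw [hg, res_res, res_res, ← res_res L (inf_le_left : W ⊓ U i ≤ W) h', hg, ← (φ' i).2.2,
      res_res]
  · intro i
    refine homSubgroup.ext fun W hW s => ?_
    have hW' : W ≤ iSup U := hW.trans (le_iSup U i)
    change g W hW' s = (φ' i).1 ⟨W, hW⟩ s
    refine uniq W hW' _ _ fun j => ?_
    rw [hg, ← (φ' i).2.2]
    exact compat j i _ _ _ _
  · intro ψ hψ
    let ψ' : homSubgroup F L (iSup U) := ψ
    have hψ' : ∀ i (W : X.Opens) (hW : W ≤ U i) (s : Γ(F, W)),
        ψ'.1 ⟨W, hW.trans (le_iSup U i)⟩ s = (φ' i).1 ⟨W, hW⟩ s := fun i W hW s =>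
      congr($(congrArg Subtype.val (hψ i)) ⟨W, hW⟩ s)
    refine homSubgroup.ext fun W hW s => ?_
    change ψ'.1 ⟨W, hW⟩ s = g W hW s
    refine uniq W hW _ _ fun i => ?_
    rw [hg, ← ψ'.2.2]
    exact hψ' i _ _ _

variable (F L) in
/-- The `𝒪_X`-module `ℋom(F, L)` of linear maps from `F` to `L`. If `F` is a vector bundle and `L` is
a line bundle, this is the twisted dual bundle `F^*(L) = F^* ⊗ L`. -/
noncomputable def sheafHom : X.Modules where
  val := homPresheafOfModules F L
  isSheaf := homPresheaf_isSheaf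

/-- The value `φ(s)` of a section `φ` of `ℋom(F, L)` over `U` at a section `s` of `F` over `U`. -/
noncomputable def evalHom {U : X.Opens} (φ : Γ(sheafHom F L, U)) (s : Γ(F, U)) : Γ(L, U) :=
  (show homSubgroup F L U from φ).1 ⟨U, le_rfl⟩ s

/-- The morphism `g^* : ℋom(V, L) ⟶ ℋom(F, L)`, `φ ↦ φ ∘ g`. -/
noncomputable def sheafHomPrecomp {V : X.Modules} (g : F ⟶ V) (L : X.Modules) :
    sheafHom V L ⟶ sheafHom F L where
  val := PresheafOfModules.homMk
    { app U := AddCommGrpCat.ofHom (Y := (homPresheaf F L).obj U) (X := (homPresheaf V L).obj U)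
       { toFun := fun φ : homSubgroup V L U.unop => 
          (⟨fun W => (φ.1 W).comp (g.app W.1).hom, fun W hW r s => by
            simp [φ.2.1], fun W W' hW h s => by
            simp [app_res, φ.2.2 W W' hW h]⟩ : homSubgroup F L U.unop)
         map_zero' := rfl
         map_add' _ _ := rfl } } (fun U r m => rfl)

/-- A quadratic form on `V` with values in `L`: quadratic maps `V(U) → L(U)` over `𝒪(U)`, for all
open `U`, which commute with restriction. If `V` is a vector bundle and `L` is a line bundle, these
are the global sections of `S^2(V^*) ⊗ L`. -/
structure SheafQuadraticForm (V L : X.Modules) where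
  app (U : X.Opens) : QuadraticMap Γ(X, U) Γ(V, U) Γ(L, U)
  app_res {U W : X.Opens} (h : W ≤ U) (s : Γ(V, U)) : app W (res V h s) = res L h (app U s)

/-- The linear map `b(v, ·) : V|_U → L|_U` given by a section `v` of `V` over `U` and the symmetric
bilinear form `b(v, w) = q(v + w) - q(v) - q(w)` associated with `q`. -/
noncomputable def SheafQuadraticForm.polarSection {V L : X.Modules} (q : SheafQuadraticForm V L)
    (U : X.Opens) : Γ(V, U) →+ homSubgroup V L U where
  toFun v := ⟨fun W => ((q.app W.1).polarBilin (res V W.2 v)).toAddMonoidHom,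
    fun W hW r s => by simp,
    fun W W' hW h s => by
      simp [QuadraticMap.polar, q.app_res, ← map_add, ← res_res V hW h]⟩
  map_zero' := homSubgroup.ext fun W hW s => by
    change (q.app W).polarBilin (res V hW 0) s = 0
    simp
  map_add' v w := homSubgroup.ext fun W hW s => by
    change (q.app W).polarBilin (res V hW (v + w)) s =
      (q.app W).polarBilin (res V hW v) s + (q.app W).polarBilin (res V hW w) s
    simp

lemma SheafQuadraticForm.polarSection_smul {V L : X.Modules} (q : SheafQuadraticForm V L)
    (U : X.Opens) (r : Γ(X, U)) (v : Γ(V, U)) :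
    q.polarSection U (r • v) = r • q.polarSection U v :=
  homSubgroup.ext fun W hW s => by
    change (q.app W).polarBilin (res V hW (r • v)) s =
      resO hW r • (q.app W).polarBilin (res V hW v) s
    rw [res_smul, map_smul]
    rfl

/-- The morphism `β : V ⟶ ℋom(V, L)`, `v ↦ b(v, ·)`. -/
noncomputable def SheafQuadraticForm.polarHom {V L : X.Modules} (q : SheafQuadraticForm V L) :
    V ⟶ sheafHom V L where
  val := PresheafOfModules.homMk
    { app U := AddCommGrpCat.ofHom (X := V.presheaf.obj U) (Y := (homPresheaf V L).obj U)
        (q.polarSection U.unop)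
      naturality := by
        intro U U' i
        ext v
        refine homSubgroup.ext fun W hW s => ?_
        exact congrArg (fun t => (q.app W).polarBilin t s) (res_res V i.unop.le hW v) }
    (fun U r v => q.polarSection_smul U.unop r v)

/-- The sections `e 0, …, e (n - 1)` of `M` over `U` form a frame: the morphism `𝒪_U^n → M|_U`,
`c ↦ ∑ i, c i • e i`, is an isomorphism. -/
def IsFrame (M : X.Modules) {U : X.Opens} {n : ℕ} (e : Fin n → Γ(M, U)) : Prop :=
  ∀ (W : X.Opens) (hW : W ≤ U),
    Function.Bijective fun c : Fin n → Γ(X, W) => ∑ i, c i • res M hW (e i)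

/-- `M` is a vector bundle of constant rank `n`: locally isomorphic to `𝒪^n`. -/
def IsVectorBundle (M : X.Modules) (n : ℕ) : Prop :=
  ∀ x : X, ∃ U : X.Opens, x ∈ U ∧ ∃ e : Fin n → Γ(M, U), IsFrame M e

/-- `M` is locally free of finite rank (the rank may vary with the point). -/
def IsFiniteLocallyFree (M : X.Modules) : Prop :=
  ∀ x : X, ∃ U : X.Opens, x ∈ U ∧ ∃ (n : ℕ) (e : Fin n → Γ(M, U)), IsFrame M e

variable (X) in
/-- A twisted orthogonal bundle: a vector bundle `V` with a nonsingular quadratic form `q` with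
values in a line bundle `L`. Nonsingular means that the associated bilinear form is a perfect
pairing, i.e. that it induces an isomorphism from `V` to `V^*(L)`. -/
structure TwistedOrthogonalBundle where
  V : X.Modules
  rank : ℕ
  isVectorBundle : IsVectorBundle V rank
  L : X.Modules
  isLineBundle : IsVectorBundle L 1
  q : SheafQuadraticForm V L
  nonsingular : IsIso q.polarHom

/-- A Lagrangian subbundle of a twisted orthogonal bundle of even rank `2 n`: a subbundle
`incl : E ↪ V` of rank `n` (with locally free quotient) such that `q` vanishes on `E`. -/
structure LagrangianSubbundle (B : TwistedOrthogonalBundle X) where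
  E : X.Modules
  incl : E ⟶ B.V
  mono : Mono incl
  rank : ℕ
  two_mul_rank : 2 * rank = B.rank
  isVectorBundle : IsVectorBundle E rank
  quotient_locallyFree : IsFiniteLocallyFree (Limits.cokernel incl)
  isotropic : ∀ (U : X.Opens) (s : Γ(E, U)), B.q.app U (incl.app U s) = 0

namespace LagrangianSubbundle

variable {B : TwistedOrthogonalBundle X}

/-- The composite `λ : E ⟶ V ⟶ V^*(L) ⟶ F^*(L)` of the inclusion of `E`, the isomorphism induced
by `q`, and the transpose of the inclusion of `F`. -/
noncomputable def comparison (E F : LagrangianSubbundle B) : E.E ⟶ sheafHom F.E B.L :=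
  E.incl ≫ B.q.polarHom ≫ sheafHomPrecomp F.incl B.L

/-- The subspace `E(x) ∩ F(x)` of the fibre `V(x)`. -/
noncomputable def fiberInter (E F : LagrangianSubbundle B) (x : X) :
    Submodule (IsLocalRing.ResidueField (X.presheaf.stalk x)) (Fiber B.V x) :=
  LinearMap.range (fiberMap E.incl x) ⊓ LinearMap.range (fiberMap F.incl x)

end LagrangianSubbundle

/-- A morphism `ζ : F|_U ⟶ ℋom(F, L)|_U` is alternating if `ζ(s)(s) = 0` for all local sections
`s` of `F|_U`. -/
def IsAlternatingOn (U : X.Opens)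
    (ζ : F.restrict U.ι ⟶ (sheafHom F L).restrict U.ι) : Prop :=
  ∀ (W : (U : Scheme.{u}).Opens) (s : Γ(F.restrict U.ι, W)),
    evalHom (((sheafHom F L).restrictAppIso U.ι W).hom (ζ.app W s))
      ((F.restrictAppIso U.ι W).hom s) = 0

/-- A morphism `φ : E ⟶ ℋom(F, L)` is locally alternating if `X` is covered by open subsets `U`
with isomorphisms `i : F|_U ≅ E|_U` such that `φ|_U ∘ i` is alternating. -/
def IsLocallyAlternating {E : X.Modules} (φ : E ⟶ sheafHom F L) : Prop :=
  ∀ x : X, ∃ U : X.Opens, x ∈ U ∧ ∃ i : F.restrict U.ι ≅ E.restrict U.ι,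
    IsAlternatingOn U (i.hom ≫ (Scheme.Modules.restrictFunctor U.ι).map φ)

end SheafModules

/-! Put `μ : V ⟶ F^*(L)`, `v ↦ b(v, ·)|_F`. On the fibre at `x` it is onto, since `b` is perfect and
`F` is locally a direct summand, and its kernel has dimension `2n - n = n` and contains `F(x)`, so
equals it. As `λ` is `μ` restricted to `E`, the kernel of `λ(x)` is `E(x) ∩ F(x)`. Hence `dim (E(x)
∩ F(x)) + rank λ(x) = n`, which is (a) ⇔ (b). If `λ` is locally alternating, its matrix in suitable
frames is alternating, and alternating matrices over a field have even rank; this is (c) ⇒ (a).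

For (a) ⇒ (c), work near `x` with a frame `f` of `F` and a generator of `L`. A family dual to `f`
can be corrected, without dividing by 2, to an isotropic dual family `c'`. A frame of `E` then reads
`e = A f + M c'`, where `M` is the matrix of `λ`, and isotropy of `E` says that `A Mᵀ` is
alternating. If `A` were invertible, `A⁻¹ M` would be alternating and `A⁻¹ e` would be the required
frame of `E`. In general, replace `c'` by `c' + S f` with `S` alternating: this is again an
isotropic dual family, and it turns `A` into `A - M S` without changing `M`.

It remains to choose `S` with `A - M S` invertible. At `x` this is linear algebra over `k(x)`, and
it is the place where the even rank of `M(x)` enters (`exists_isAlternating_det_sub_mul_ne_zero`).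
An alternating lift of `S` keeps the determinant invertible near `x`, and `mul_of_mul_sub_eq_one`
concludes. -/

/-! ### Alternating matrices over a commutative ring. -/

namespace Matrix

/-- A square matrix is alternating if it is skew-symmetric with zero diagonal. -/
structure IsAlternating {n R : Type*} [CommRing R] (M : Matrix n n R) : Prop where
  diag : ∀ i, M i i = 0
  skew : ∀ i j, M i j = -M j i

section

variable {n R : Type*} [CommRing R]

/-- The terms at `(i, j)` and `(j, i)` cancel and the diagonal terms vanish, so nothing has to be
divided by 2. -/
lemma IsAlternating.sum_eq_zero [Fintype n] {M : Matrix n n R} (hM : M.IsAlternating) (v : n → R) :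
    ∑ i, ∑ j, v i * M i j * v j = 0 := by
  classical
  rw [← Finset.sum_product']
  refine Finset.sum_involution (fun p _ => (p.2, p.1)) ?_ ?_ (by simp) (by simp)
  · rintro ⟨i, j⟩ -
    simp only [hM.skew i j]
    ring
  · rintro ⟨i, j⟩ - h heq
    obtain rfl : j = i := congrArg Prod.fst heq
    simp [hM.diag] at h

lemma IsAlternating.neg {M : Matrix n n R} (hM : M.IsAlternating) : (-M).IsAlternating :=
  ⟨fun i => by simp [hM.diag], fun i j => by simp [hM.skew j i]⟩

lemma IsAlternating.sub {M N : Matrix n n R} (hM : M.IsAlternating) (hN : N.IsAlternating) :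
    (M - N).IsAlternating :=
  ⟨fun i => by simp [hM.diag, hN.diag], fun i j => by
    simp only [sub_apply, hM.skew i j, hN.skew i j]; ring⟩

lemma IsAlternating.transpose_eq {M : Matrix n n R} (hM : M.IsAlternating) : Mᵀ = -M := by
  ext i j
  exact hM.skew j i

/-- The diagonal entries are values of `v ↦ v M vᵀ` on the rows of `P`; skew-symmetry alone would
not make them vanish in characteristic 2. -/
lemma IsAlternating.congruence [Fintype n] {M : Matrix n n R} (hM : M.IsAlternating) (P : Matrix n n R) :
    (P * M * Pᵀ).IsAlternating := by
  constructor
  · intro i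
    rw [← hM.sum_eq_zero (P i)]
    simp only [mul_apply, transpose_apply, Finset.sum_mul]
    exact Finset.sum_comm
  · intro i j
    have h : (P * M * Pᵀ)ᵀ = -(P * M * Pᵀ) := by
      simp [transpose_mul, hM.transpose_eq, Matrix.mul_assoc]
    exact congr($h j i)

lemma IsAlternating.map {S : Type*} [CommRing S] {M : Matrix n n R} (hM : M.IsAlternating)
    (φ : R →+* S) : (M.map φ).IsAlternating :=
  ⟨fun i => by simp [hM.diag], fun i j => by simp [hM.skew i j]⟩

/-- If `A Bᵀ` and `S` are alternating and `A - B S` is invertible, then `(A - B S)⁻¹ B` is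
alternating. -/
lemma IsAlternating.mul_of_mul_sub_eq_one [Fintype n] [DecidableEq n] {A B S P : Matrix n n R}
    (hAB : (A * Bᵀ).IsAlternating) (hS : S.IsAlternating) (hP : P * (A - B * S) = 1) :
    (P * B).IsAlternating := by
  have h1 : ((A - B * S) * Bᵀ).IsAlternating := by
    rw [Matrix.sub_mul]
    exact hAB.sub (hS.congruence B)
  have h2 : B * (A - B * S)ᵀ = -((A - B * S) * Bᵀ) := by
    rw [← h1.transpose_eq]; simp
  have h3 : (A - B * S)ᵀ * Pᵀ = 1 := by rw [← transpose_mul, hP, transpose_one]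
  -- Inserting `(A - B S)ᵀ Pᵀ = 1` on the right exhibits `P B` as a congruence transform by `P` of
  -- an alternating matrix.
  have h4 : P * B = P * (B * (A - B * S)ᵀ) * Pᵀ := by
    rw [Matrix.mul_assoc, Matrix.mul_assoc, h3, Matrix.mul_one]
  rw [h4, h2]
  exact h1.neg.congruence P

end

end Matrix

/-! ### Alternating forms over a field. -/

namespace LinearMap.BilinForm

variable {k V : Type*} [Field k] [AddCommGroup V] [Module k V] [FiniteDimensional k V]

/-- An alternating form has a self-orthogonal subspace. -/
lemma IsAlt.exists_orthogonal_eq_self {b : LinearMap.BilinForm k V} (hb : b.IsAlt) :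
    ∃ W : Submodule k V, b.orthogonal W = W := by
  let P : Set (Submodule k V) := {W | W ≤ b.orthogonal W}
  obtain ⟨W, hW, hmax⟩ : ∃ W, Maximal (· ∈ P) W := by
    obtain ⟨m, hm⟩ := exists_maximal_of_wellFoundedGT (fun W => W ∈ P) ⟨⊥, bot_le (α := Submodule k V)⟩
    exact ⟨m, hm⟩
  refine ⟨W, le_antisymm (fun w hw => ?_) hW⟩
  have hw' : ∀ v ∈ W, b v w = 0 := fun v hv => hw v hv
  -- A vector orthogonal to a maximal isotropic `W` can be adjoined to it, because `b w w = 0`; so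
  -- it already lies in `W`.
  have h : W ⊔ k ∙ w ∈ P := by
    intro v hv u hu
    obtain ⟨v1, hv1, v2, hv2, rfl⟩ := Submodule.mem_sup.1 hv
    obtain ⟨u1, hu1, u2, hu2, rfl⟩ := Submodule.mem_sup.1 hu
    obtain ⟨r, rfl⟩ := Submodule.mem_span_singleton.1 hv2
    obtain ⟨s, rfl⟩ := Submodule.mem_span_singleton.1 hu2
    have h1 : b u1 v1 = 0 := hW hv1 u1 hu1
    have h2 : b w v1 = 0 := by rw [hb.eq_iff]; exact hw' v1 hv1
    simp [h1, h2, hw' u1 hu1, hb.self_eq_zero]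
  exact hmax h le_sup_left (Submodule.mem_sup_right (Submodule.mem_span_singleton_self w))

/-- A subspace `W` equal to its orthogonal contains the radical, so the dimension formula reads `2
dim W = dim V + dim rad`. Hence the rank `dim V - dim rad` is `2 (dim W - dim rad)`. -/
lemma IsAlt.even_finrank_range {b : LinearMap.BilinForm k V} (hb : b.IsAlt) :
    Even (Module.finrank k (LinearMap.range b)) := by
  obtain ⟨W, hW⟩ := hb.exists_orthogonal_eq_self
  have h1 := LinearMap.BilinForm.finrank_add_finrank_orthogonal hb.isRefl W
  have h2 : W ⊓ b.orthogonal ⊤ = b.orthogonal ⊤ :=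
    inf_eq_right.2 (hW ▸ b.orthogonal_le le_top)
  have h3 : b.orthogonal ⊤ = LinearMap.ker b := by
    ext v
    simp only [LinearMap.BilinForm.mem_orthogonal_iff, Submodule.mem_top, true_imp_iff,
      LinearMap.mem_ker, LinearMap.ext_iff]
    exact forall_congr' fun w => hb.eq_iff
  have h4 := LinearMap.finrank_range_add_finrank_ker b
  rw [h2, h3, hW] at h1
  exact ⟨Module.finrank k W - Module.finrank k (LinearMap.ker b), by omega⟩

end LinearMap.BilinForm

/-! ### Alternating matrices over a field, and the choice of `S`. -/

namespace Matrix

variable {k n : Type*} [Field k] [Fintype n] [DecidableEq n]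

lemma IsAlternating.isAlt_toBilin' {M : Matrix n n k} (hM : M.IsAlternating) :
    (Matrix.toBilin' M).IsAlt := fun v => by
  rw [Matrix.toBilin'_apply]
  exact hM.sum_eq_zero v

lemma IsAlternating.even_rank {M : Matrix n n k} (hM : M.IsAlternating) : Even M.rank := by
  have h := hM.isAlt_toBilin'.even_finrank_range
  have h1 := LinearMap.finrank_range_add_finrank_ker (Matrix.toBilin' M)
  have h2 := LinearMap.finrank_range_add_finrank_ker (Mᵀ).mulVecLin
  -- The left radical of the form is the kernel of `Mᵀ`, so the form and the matrix have the same
  -- rank.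
  have h3 : LinearMap.ker (Matrix.toBilin' M) = LinearMap.ker (Mᵀ).mulVecLin := by
    ext v
    simp only [LinearMap.mem_ker, mulVecLin_apply, mulVec_transpose]
    constructor
    · intro h
      funext j
      have := LinearMap.congr_fun h (Pi.single j 1)
      rw [Matrix.toBilin'_apply'] at this
      exact (by simpa [dotProduct_mulVec] using this : v ⬝ᵥ M.col j = 0)
    · intro h
      ext j
      simp only [Matrix.toBilin'_apply', dotProduct_mulVec, h, LinearMap.comp_apply]
      simp
  rw [← Matrix.rank_transpose, Matrix.rank]
  rw [h3] at h1
  rwa [show Module.finrank k (LinearMap.range (Mᵀ).mulVecLin) =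
    Module.finrank k (LinearMap.range (Matrix.toBilin' M)) by omega]

lemma isAlternating_J (l R : Type*) [DecidableEq l] [CommRing R] : (J l R).IsAlternating := by
  constructor
  · rintro (i | i) <;> simp [J]
  · intro i j
    exact congr($(J_transpose l R) j i)

/-- An even-dimensional space has a nondegenerate alternating form. -/
lemma exists_isAlt_separating {R : Type*} [AddCommGroup R] [Module k R] [FiniteDimensional k R]
    (h : Even (Module.finrank k R)) : ∃ ω : LinearMap.BilinForm k R, ω.IsAlt ∧
      ∀ x, (∀ y, ω x y = 0) → x = 0 := by
  obtain ⟨m, hm⟩ := h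
  let φ : R ≃ₗ[k] (Fin m ⊕ Fin m → k) :=
    ((Module.finBasis k R).reindex ((finCongr hm).trans finSumFinEquiv.symm)).equivFun
  let j := Matrix.toBilin' (J (Fin m) k)
  refine ⟨j.comp φ.toLinearMap φ.toLinearMap,
    fun x => (isAlternating_J (Fin m) k).isAlt_toBilin' (φ x), fun x hx => ?_⟩
  have h1 : φ x ᵥ* J (Fin m) k = 0 := by
    ext i
    have := hx (φ.symm (Pi.single i 1))
    simp only [LinearMap.BilinForm.comp_apply, LinearEquiv.coe_coe, LinearEquiv.apply_symm_apply,
      j, Matrix.toBilin'_apply'] at this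
    exact (by simpa [dotProduct_mulVec] using this : φ x ⬝ᵥ (J (Fin m) k).col i = 0)
  -- Nondegeneracy comes from `J² = -1`.
  have h2 : (φ x ᵥ* J (Fin m) k) ᵥ* J (Fin m) k = 0 := by rw [h1, zero_vecMul]
  rw [vecMul_vecMul, J_squared] at h2
  have h3 : φ x = 0 := by simpa [vecMul_neg] using h2
  simpa using h3

/-- If `A Bᵀ` is alternating, the rows of `(A | B)` are independent and `B` has even rank, then
`A - B S` is invertible for some alternating matrix `S`. -/
lemma exists_isAlternating_det_sub_mul_ne_zero {A B : Matrix n n k}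
    (hAB : (A * Bᵀ).IsAlternating) (hu : ∀ u, u ᵥ* A = 0 → u ᵥ* B = 0 → u = 0)
    (hB : Even B.rank) : ∃ S : Matrix n n k, S.IsAlternating ∧ (A - B * S).det ≠ 0 := by
  let b := B.vecMulLinear
  let R := LinearMap.range b
  have hR : Even (Module.finrank k R) := by
    rwa [← Matrix.rank_transpose, Matrix.rank, mulVecLin_transpose] at hB
  obtain ⟨s, hs⟩ := b.rangeRestrict.exists_rightInverse_of_surjective b.range_rangeRestrict
  obtain ⟨π, hπ⟩ := R.subtype.exists_leftInverse_of_injective R.ker_subtype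
  have hs' (y : R) : s y ᵥ* B = y := congrArg Subtype.val (LinearMap.congr_fun hs y)
  have hπ' (y : R) : π y = y := LinearMap.congr_fun hπ y
  obtain ⟨ω, hω, hω'⟩ := exists_isAlt_separating hR
  have hdot (u w : n → k) : (u ᵥ* A) ⬝ᵥ (w ᵥ* B) = Matrix.toBilin' (A * Bᵀ) u w := by
    rw [Matrix.toBilin'_apply', ← mulVec_mulVec, mulVec_transpose, dotProduct_mulVec]
  -- On the row space `R` of `B`, the rule `(u B, w B) ↦ u A ⬝ w B` does not depend on the choice of
  -- `u`: the value is `u (A Bᵀ) wᵀ`, which is skew in `u, w` and visibly depends on `w` only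
  -- through `w B`.
  let α : LinearMap.BilinForm k R := LinearMap.mk₂ k (fun y z => (s y ᵥ* A) ⬝ᵥ (z : n → k))
    (by simp [add_vecMul]) (by simp [smul_vecMul]) (by simp) (by simp)
  have hα : α.IsAlt := fun y => by
    change (s y ᵥ* A) ⬝ᵥ (y : n → k) = 0
    rw [← hs' y, hdot]
    exact hAB.isAlt_toBilin' _
  have hα' (u w : n → k) (hu : u ᵥ* B ∈ R) (hw : w ᵥ* B ∈ R) :
      α ⟨u ᵥ* B, hu⟩ ⟨w ᵥ* B, hw⟩ = (u ᵥ* A) ⬝ᵥ (w ᵥ* B) := by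
    change (s ⟨u ᵥ* B, hu⟩ ᵥ* A) ⬝ᵥ (w ᵥ* B) = _
    rw [hdot, hdot, ← hAB.isAlt_toBilin'.neg_eq w, ← hAB.isAlt_toBilin'.neg_eq w u, ← hdot, ← hdot,
      hs']
  -- `S` is the matrix of `α - ω`, extended from `R` to the whole space by a projection, with `ω`
  -- nondegenerate on the even-dimensional `R`.
  let τ : LinearMap.BilinForm k (n → k) := (α - ω).comp π π
  have hτ : τ.IsAlt := fun y => hα.sub hω (π y)
  refine ⟨LinearMap.BilinForm.toMatrix' τ, ⟨fun i => ?_, fun i j => ?_⟩, fun hdet => ?_⟩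
  · rw [LinearMap.BilinForm.toMatrix'_apply, hτ]
  · rw [LinearMap.BilinForm.toMatrix'_apply, LinearMap.BilinForm.toMatrix'_apply, hτ.neg_eq]
  -- If `u A = u B S`, pairing with `w B` gives `α = α - ω` at `(u B, w B)`. So `u B` is in the
  -- radical of `ω`, hence zero; then `u A = 0` as well, against the independence of the rows.
  · obtain ⟨u, hu0, hu1⟩ := Matrix.exists_vecMul_eq_zero_iff.2 hdet
    rw [vecMul_sub, ← vecMul_vecMul, sub_eq_zero] at hu1
    have hmem (w : n → k) : w ᵥ* B ∈ R := ⟨w, rfl⟩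
    have h1 (w : n → k) : ω ⟨u ᵥ* B, hmem u⟩ ⟨w ᵥ* B, hmem w⟩ = 0 := by
      have h2 : τ (u ᵥ* B) (w ᵥ* B) = (u ᵥ* A) ⬝ᵥ (w ᵥ* B) := by
        rw [hu1, ← dotProduct_mulVec, ← Matrix.toBilin'_apply', Matrix.toBilin'_toMatrix']
      have h3 : τ (u ᵥ* B) (w ᵥ* B) = α ⟨u ᵥ* B, hmem u⟩ ⟨w ᵥ* B, hmem w⟩ -
          ω ⟨u ᵥ* B, hmem u⟩ ⟨w ᵥ* B, hmem w⟩ := by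
        rw [← hπ' ⟨u ᵥ* B, hmem u⟩, ← hπ' ⟨w ᵥ* B, hmem w⟩]
        rfl
      rw [h2, hα'] at h3
      exact (sub_eq_self.1 h3.symm)
    have h4 : u ᵥ* B = 0 := by
      refine congrArg Subtype.val (hω' ⟨u ᵥ* B, hmem u⟩ ?_)
      rintro ⟨_, w, rfl⟩
      exact h1 w
    exact hu0 (hu u (by rw [hu1, h4, zero_vecMul]) h4)

end Matrix

/-! ### Isotropic families and hyperbolic coordinates. -/

namespace QuadraticMap

variable {R V : Type*} [CommRing R] [AddCommGroup V] [Module R V] (Q : QuadraticForm R V)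
  {n : ℕ}

lemma polar_sum_smul_left {ι : Type*} (s : Finset ι) (a : ι → R) (v : ι → V) (w : V) :
    polar Q (∑ i ∈ s, a i • v i) w = ∑ i ∈ s, a i * polar Q (v i) w := by
  have h := map_sum (Q.polarBilin.flip w) (fun i => a i • v i) s
  simpa only [LinearMap.flip_apply, polarBilin_apply_apply, map_smul, LinearMap.smul_apply,
    smul_eq_mul] using h

/-- A quadratic form vanishes on the span of a totally isotropic family. -/
lemma map_sum_smul_eq_zero {ι : Type*} {w : ι → V} (hw : ∀ i, Q (w i) = 0)
    (hww : ∀ i j, polar Q (w i) (w j) = 0) (s : Finset ι) (a : ι → R) :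
    Q (∑ j ∈ s, a j • w j) = 0 := by
  classical
  induction s using Finset.induction_on with
  | empty => simp
  | insert j s hj ih =>
    rw [Finset.sum_insert hj, QuadraticMap.map_add Q, ih, QuadraticMap.map_smul, hw, polar_comm,
      polar_sum_smul_left]
    simp [hww]

/-- A family dual to an isotropic family can be modified so that it becomes isotropic. -/
lemma exists_isotropic_dual {f c : Fin n → V} (hf : ∀ i, Q (f i) = 0)
    (hff : ∀ i j, polar Q (f i) (f j) = 0)
    (hcf : ∀ i j, polar Q (c i) (f j) = if i = j then 1 else 0) :
    ∃ c' : Fin n → V, (∀ i j, polar Q (c' i) (f j) = if i = j then 1 else 0) ∧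
      (∀ i, Q (c' i) = 0) ∧ ∀ i j, i ≠ j → polar Q (c' i) (c' j) = 0 := by
  -- A triangular choice replaces the division by 2: subtracting `t i` changes `polar (c i) (c j)`
  -- by `-(a i j + a j i)` and `Q (c i)` by `-a i i`.
  let a (i j : Fin n) : R := if j < i then polar Q (c i) (c j) else if j = i then Q (c i) else 0
  let t (i : Fin n) : V := ∑ j, a i j • f j
  have htf (i j) : polar Q (t i) (f j) = 0 := by simp [t, polar_sum_smul_left, hff]
  have htt (i j) : polar Q (t i) (t j) = 0 := by
    rw [polar_comm]
    refine (polar_sum_smul_left Q _ (a j) f (t i)).trans (Finset.sum_eq_zero fun k _ => ?_)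
    rw [polar_comm, htf, mul_zero]
  have htc (i j) : polar Q (t i) (c j) = a i j := by
    refine (polar_sum_smul_left Q _ (a i) f (c j)).trans ?_
    simp [polar_comm Q _ (c j), hcf]
  have hQt (i) : Q (t i) = 0 := Q.map_sum_smul_eq_zero hf hff _ _
  have hcc (i j : Fin n) (hij : j < i) : polar Q (c i - t i) (c j - t j) = 0 := by
    rw [polar_sub_left, polar_sub_right, polar_sub_right, polar_comm Q (c i) (t j), htc, htc, htt]
    simp [a, hij, hij.ne', hij.not_gt]
  refine ⟨fun i => c i - t i, fun i j => ?_, fun i => ?_, fun i j hij => ?_⟩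
  · rw [polar_sub_left, htf, hcf, sub_zero]
  · change Q (c i - t i) = 0
    rw [sub_eq_add_neg, QuadraticMap.map_add Q, QuadraticMap.map_neg, hQt, polar_neg_right,
      polar_comm, htc]
    simp [a]
  · rcases lt_or_gt_of_ne hij with h | h
    · rw [polar_comm]; exact hcc j i h
    · exact hcc i j h

/-- In a quadratic space of rank `2 n`, any vector is a combination of the members of a hyperbolic
family with `2 n` members. -/
lemma eq_sum_of_hyperbolic {ι : Type*} [Fintype ι] (b : Module.Basis ι R V)
    (hι : Fintype.card ι = 2 * n) {f c : Fin n → V} (hff : ∀ i j, polar Q (f i) (f j) = 0)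
    (hcf : ∀ i j, polar Q (c i) (f j) = if i = j then 1 else 0)
    (hcc : ∀ i j, polar Q (c i) (c j) = 0) (v : V) :
    v = ∑ i, polar Q v (c i) • f i + ∑ i, polar Q v (f i) • c i := by
  let Ψ : V →ₗ[R] (Fin n ⊕ Fin n → R) :=
    LinearMap.pi (Sum.elim (fun i => Q.polarBilin.flip (c i)) (fun i => Q.polarBilin.flip (f i)))
  have h1 (w : V) (i) : Ψ w (Sum.inl i) = polar Q w (c i) := rfl
  have h2 (w : V) (i) : Ψ w (Sum.inr i) = polar Q w (f i) := rfl
  have hΨ (a d : Fin n → R) : Ψ (∑ i, a i • f i + ∑ i, d i • c i) = Sum.elim a d := by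
    funext i
    rcases i with i | i
    · rw [h1, polar_add_left, polar_sum_smul_left, polar_sum_smul_left]
      simp [hcc, polar_comm Q _ (c i), hcf]
    · rw [h2, polar_add_left, polar_sum_smul_left, polar_sum_smul_left]
      simp [hcf, hff]
  have hsurj : Function.Surjective Ψ := fun y =>
    ⟨_, (hΨ (y ∘ Sum.inl) (y ∘ Sum.inr)).trans (Sum.elim_comp_inl_inr y)⟩
  have e : ι ≃ Fin n ⊕ Fin n := Fintype.equivOfCardEq (by simp [hι]; ring)
  have : Module.Finite R V := Module.Finite.of_basis b
  -- A surjection between free modules of the same rank `2 n` is injective.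
  have hinj : Function.Injective Ψ :=
    OrzechProperty.injective_of_surjective_of_injective (b.reindex e).equivFun.toLinearMap Ψ
      (b.reindex e).equivFun.injective hsurj
  refine hinj ?_
  rw [hΨ]
  funext i
  rcases i with i | i <;> rfl

/-- The coordinates of an isotropic family in a hyperbolic family. -/
lemma exists_coordinates_of_isotropic {ι : Type*} [Fintype ι] (b : Module.Basis ι R V)
    (hι : Fintype.card ι = 2 * n) {f c e : Fin n → V} (hf : ∀ i, Q (f i) = 0)
    (hff : ∀ i j, polar Q (f i) (f j) = 0)
    (hcf : ∀ i j, polar Q (c i) (f j) = if i = j then 1 else 0)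
    (he : ∀ i, Q (e i) = 0) (hee : ∀ i j, polar Q (e i) (e j) = 0) :
    ∃ (c' : Fin n → V) (A : Matrix (Fin n) (Fin n) R),
      (∀ i, e i = ∑ j, A i j • f j + ∑ j, polar Q (e i) (f j) • c' j) ∧
      (A * (Matrix.of fun i j => polar Q (e i) (f j)).transpose).IsAlternating := by
  obtain ⟨c', hcf', hc', hcc'⟩ := Q.exists_isotropic_dual hf hff hcf
  have hcc (i j) : polar Q (c' i) (c' j) = 0 := by
    by_cases h : i = j
    · subst h; rw [polar_self, hc']; simp
    · exact hcc' i j h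
  have hexp := Q.eq_sum_of_hyperbolic b hι hff hcf' hcc
  refine ⟨c', Matrix.of fun i j => polar Q (e i) (c' j), fun i => hexp (e i), fun i => ?_,
    fun i j => ?_⟩
  -- Expanding `Q (e i) = 0` gives the diagonal entry of the product itself, not its double; this is
  -- where the quadratic form says more than its polar form.
  · have h := he i
    rw [hexp (e i), QuadraticMap.map_add Q, Q.map_sum_smul_eq_zero hf hff,
      Q.map_sum_smul_eq_zero hc' hcc,
      polar_sum_smul_left] at h
    have h3 (j : Fin n) : polar Q (f j) (∑ k, polar Q (e i) (f k) • c' k) = polar Q (e i) (f j) := by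
      rw [polar_comm, polar_sum_smul_left]
      simp [hcf']
    simpa [h3, Matrix.mul_apply] using h
  · have h := hee i j
    rw [hexp (e i), polar_add_left, polar_sum_smul_left, polar_sum_smul_left] at h
    simp only [Matrix.mul_apply, Matrix.of_apply, Matrix.transpose_apply]
    rw [eq_neg_iff_add_eq_zero, ← h]
    congr 1
    · exact Finset.sum_congr rfl fun k _ => by rw [polar_comm Q (f k)]
    · exact Finset.sum_congr rfl fun k _ => by rw [polar_comm Q (c' k), mul_comm]

end QuadraticMap

/-! ### Local surjectivity of epimorphisms and left exactness of sections. -/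

namespace SheafModules
variable {X : Scheme.{u}}

/-- The sections of `N` which are locally in the image of `φ : M ⟶ N`. -/
noncomputable def imageSubmodule {M N : X.Modules} (φ : M ⟶ N) :
    PresheafOfModules.Submodule N.val where
  obj U :=
    { carrier := {t : Γ(N, U.unop) | ∀ x ∈ U.unop, ∃ (W : X.Opens) (h : W ≤ U.unop) (s : Γ(M, W)),
        x ∈ W ∧ φ.app W s = res N h t}
      add_mem' := by
        intro t t' ht ht' x hx
        obtain ⟨W, hW, s, hxW, hs⟩ := ht x hx
        obtain ⟨W', hW', s', hxW', hs'⟩ := ht' x hx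
        refine ⟨W ⊓ W', inf_le_left.trans hW, res M inf_le_left s + res M inf_le_right s',
          ⟨hxW, hxW'⟩, ?_⟩
        refine (map_add (φ.app (W ⊓ W')).hom _ _).trans ?_
        refine Eq.trans ?_ (map_add (res N (inf_le_left.trans hW)) t t').symm
        refine congrArg₂ (· + ·) ?_ ?_
        · exact (app_res φ _ s).trans ((congrArg _ hs).trans (res_res N _ _ _))
        · exact (app_res φ _ s').trans ((congrArg _ hs').trans (res_res N _ _ _))
      zero_mem' := fun x hx => ⟨U.unop, le_rfl, 0, hx, by
        rw [map_zero]; exact (map_zero (res N le_rfl)).symm⟩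
      smul_mem' := by
        intro r t ht x hx
        obtain ⟨W, hW, s, hxW, hs⟩ := ht x hx
        refine ⟨W, hW, resO hW r • s, hxW, ?_⟩
        refine (φ.app_smul _ _).trans ?_
        rw [hs]
        exact (res_smul N hW r t).symm }
  map {U V} f := by
    intro t ht x hx
    obtain ⟨W, hW, s, hxW, hs⟩ := ht x (f.unop.le hx)
    refine ⟨W ⊓ V.unop, inf_le_right, res M inf_le_left s, ⟨hxW, hx⟩, ?_⟩
    refine (app_res φ _ s).trans ((congrArg _ hs).trans ((res_res N _ _ _).trans ?_))
    exact (res_res N f.unop.le _ t).symm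

/-- The image sheaf of a morphism of `𝒪_X`-modules. -/
noncomputable def imageSheaf {M N : X.Modules} (φ : M ⟶ N) : X.Modules where
  val := (imageSubmodule φ).toPresheafOfModules
  isSheaf := by
    change TopCat.Presheaf.IsSheaf (X := X.toTopCat) (imageSubmodule φ).toPresheafOfModules.presheaf
    rw [TopCat.Presheaf.isSheaf_iff_isSheafUniqueGluing]
    intro ι U t ht
    let t' : ∀ i, (imageSubmodule φ).obj (op (U i)) := t
    have hcompat (i j) : res N (inf_le_left : U i ⊓ U j ≤ U i) (t' i).1 =
        res N inf_le_right (t' j).1 := congrArg Subtype.val (ht i j)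
    obtain ⟨s, hs⟩ := res_glue N (iSup U) U (le_iSup U) le_rfl (fun i => (t' i).1) hcompat
    refine ⟨(⟨s, ?_⟩ : (imageSubmodule φ).obj (op (iSup U))), ?_, ?_⟩
    · intro x hx
      obtain ⟨i, hi⟩ := Opens.mem_iSup.1 hx
      obtain ⟨W, hW, m, hxW, hm⟩ := (t' i).2 x hi
      refine ⟨W, hW.trans (le_iSup U i), m, hxW, ?_⟩
      rw [hm, ← res_res N (le_iSup U i) hW, hs]
    · intro i
      exact Subtype.ext (hs i)
    · intro y hy
      let y' : (imageSubmodule φ).obj (op (iSup U)) := y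
      refine Subtype.ext (?_ : y'.1 = s)
      refine res_ext N (iSup U) U (le_iSup U) le_rfl fun i => ?_
      exact (congrArg Subtype.val (hy i) : _).trans (hs i).symm

/-- The inclusion of the image sheaf. -/
noncomputable def imageSheafι {M N : X.Modules} (φ : M ⟶ N) : imageSheaf φ ⟶ N where
  val := (imageSubmodule φ).ι

/-- The corestriction of a morphism to its image sheaf. -/
noncomputable def toImageSheaf {M N : X.Modules} (φ : M ⟶ N) : M ⟶ imageSheaf φ where
  val := PresheafOfModules.homMk
    { app U := AddCommGrpCat.ofHom (X := M.presheaf.obj U) (Y := (imageSheaf φ).presheaf.obj U)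
        (((φ.app U.unop).hom.codRestrict ((imageSubmodule φ).obj U).toAddSubgroup
          fun s x hx => ⟨U.unop, le_rfl, s, hx, (res_self N _ _).symm⟩))
      naturality := by
        intro U V i
        ext s
        exact Subtype.ext (app_res φ i.unop.le s) }
    (fun U r s => Subtype.ext (φ.app_smul r s))

lemma toImageSheaf_comp_imageSheafι {M N : X.Modules} (φ : M ⟶ N) :
    toImageSheaf φ ≫ imageSheafι φ = φ := by
  ext U s
  rfl

/-- An epimorphism of `𝒪_X`-modules is locally surjective. -/
lemma exists_local_lift_of_epi {M N : X.Modules} (φ : M ⟶ N) [Epi φ] {U : X.Opens} (t : Γ(N, U))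
    {x : X} (hx : x ∈ U) :
    ∃ (W : X.Opens) (h : W ≤ U) (s : Γ(M, W)), x ∈ W ∧ φ.app W s = res N h t := by
  -- The inclusion of the image sheaf is both mono and epi, hence an isomorphism, so every section
  -- of `N` is locally in the image.
  have h1 : Epi (imageSheafι φ) := by
    have : Epi (toImageSheaf φ ≫ imageSheafι φ) := by
      rwa [toImageSheaf_comp_imageSheafι]
    exact epi_of_epi (toImageSheaf φ) _
  have h2 : Mono (imageSheafι φ) := by
    refine (Scheme.Modules.toPresheafOfModules X).mono_of_mono_map ?_
    exact inferInstanceAs (Mono (imageSubmodule φ).ι)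
  have h3 : IsIso (imageSheafι φ) := isIso_of_mono_of_epi _
  have h4 : IsIso ((imageSheafι φ).app U) := inferInstance
  obtain ⟨t', rfl⟩ := ((ConcreteCategory.isIso_iff_bijective _).1 h4).2 t
  exact (show (imageSubmodule φ).obj (op U) from t').2 x hx

noncomputable instance (U : X.Opens) : Limits.PreservesFiniteLimits
    (Scheme.Modules.toPresheaf X ⋙ (evaluation _ _).obj (op U)) :=
  have : Limits.PreservesLimits (Scheme.Modules.toPresheaf X) := inferInstance
  have : Limits.PreservesFiniteLimits (Scheme.Modules.toPresheaf X) :=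
    Limits.PreservesLimits.preservesFiniteLimits _
  have : Limits.PreservesFiniteLimits ((evaluation (Opens X)ᵒᵖ Ab.{u}).obj (op U)) := by
    constructor; infer_instance
  Limits.comp_preservesFiniteLimits _ _

lemma app_injective_of_mono {M N : X.Modules} (φ : M ⟶ N) [Mono φ] (U : X.Opens) :
    Function.Injective (φ.app U) := by
  have : Mono ((Scheme.Modules.toPresheaf X ⋙ (evaluation _ _).obj (op U)).map φ) := inferInstance
  exact (AddCommGrpCat.mono_iff_injective _).1 this

/-- A monomorphism is the kernel of its cokernel, and taking sections over `U` preserves kernels. -/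
lemma exists_app_eq_of_cokernel_eq_zero {M N : X.Modules} (φ : M ⟶ N) [Mono φ] {U : X.Opens}
    (t : Γ(N, U)) (ht : (Limits.cokernel.π φ).app U t = 0) : ∃ s, φ.app U s = t := by
  let S := ShortComplex.mk φ (Limits.cokernel.π φ) (Limits.cokernel.condition φ)
  have hS : S.Exact := ShortComplex.exact_cokernel φ
  have : Mono S.f := ‹Mono φ›
  let G := Scheme.Modules.toPresheaf X ⋙ (evaluation _ _).obj (op U)
  have hG := hS.map_of_mono_of_preservesKernel G inferInstance inferInstance
  exact (ShortComplex.ab_exact_iff _).1 hG t ht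

/-! ### Frames and matrices. -/

/-- The family `e` of sections of `M` over `U` is a basis over every open subset of `U`. -/
def IsFreeOn (M : X.Modules) {U : X.Opens} {ι : Type*} [Fintype ι] (e : ι → Γ(M, U)) : Prop :=
  ∀ (W : X.Opens) (hW : W ≤ U),
    Function.Bijective fun c : ι → Γ(X, W) => ∑ i, c i • res M hW (e i)

/-- A morphism on sections, as a linear map. -/
noncomputable def appLinear {M N : X.Modules} (φ : M ⟶ N) (U : X.Opens) :
    Γ(M, U) →ₗ[Γ(X, U)] Γ(N, U) where
  __ := (φ.app U).hom
  map_smul' r s := φ.app_smul r s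

lemma app_sum_smul {M N : X.Modules} (φ : M ⟶ N) {U : X.Opens} {ι : Type*} (s : Finset ι)
    (c : ι → Γ(X, U)) (e : ι → Γ(M, U)) :
    φ.app U (∑ i ∈ s, c i • e i) = ∑ i ∈ s, c i • φ.app U (e i) := by
  have h : appLinear φ U (∑ i ∈ s, c i • e i) = ∑ i ∈ s, c i • appLinear φ U (e i) := by
    simp only [map_sum, map_smul]
  exact h

lemma res_sum_smul (M : X.Modules) {U W : X.Opens} (h : W ≤ U) {ι : Type*} (s : Finset ι)
    (c : ι → Γ(X, U)) (e : ι → Γ(M, U)) :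
    res M h (∑ i ∈ s, c i • e i) = ∑ i ∈ s, resO h (c i) • res M h (e i) := by
  rw [map_sum]
  exact Finset.sum_congr rfl fun i _ => res_smul M h _ _

namespace IsFreeOn

variable {M : X.Modules} {U : X.Opens} {ι : Type*} [Fintype ι] {e : ι → Γ(M, U)}

lemma restrict (he : IsFreeOn M e) {W : X.Opens} (h : W ≤ U) :
    IsFreeOn M fun i => res M h (e i) := fun W' h' => by
  simpa only [res_res] using he W' (h'.trans h)

/-- The basis of `M(U)` given by a frame. -/
noncomputable def basis (he : IsFreeOn M e) : Module.Basis ι Γ(X, U) Γ(M, U) :=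
  Module.Basis.ofEquivFun (LinearEquiv.ofBijective (Fintype.linearCombination Γ(X, U) e) (by
    have h := he U le_rfl
    simp only [res_self] at h
    exact h)).symm

lemma basis_apply (he : IsFreeOn M e) (i : ι) : he.basis i = e i := by
  classical
  simp only [basis, Module.Basis.coe_ofEquivFun, LinearEquiv.symm_symm]
  exact (Fintype.linearCombination_apply_single _ _ _ _).trans (one_smul _ _)

lemma sum_repr (he : IsFreeOn M e) (s : Γ(M, U)) : ∑ i, he.basis.repr s i • e i = s := by
  conv_rhs => rw [← he.basis.sum_repr s]
  simp only [basis_apply]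

/-- Applying an invertible matrix to a frame gives a frame. -/
lemma matrix_mul [DecidableEq ι] (he : IsFreeOn M e) {P Q : Matrix ι ι Γ(X, U)} (hPQ : P * Q = 1) :
    IsFreeOn M fun i => ∑ j, P i j • e j := by
  intro W hW
  have h1 : (P.map (resO hW)) * Q.map (resO hW) = 1 := by
    rw [← Matrix.map_mul, hPQ, Matrix.map_one _ (map_zero _) (map_one _)]
  have h2 := mul_eq_one_comm.1 h1
  have h3 : (fun c : ι → Γ(X, W) => ∑ i, c i • res M hW (∑ j, P i j • e j)) =
      (fun c : ι → Γ(X, W) => ∑ i, c i • res M hW (e i)) ∘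
        fun c => Matrix.vecMul c (P.map (resO hW)) := by
    funext c
    simp only [res_sum_smul, Finset.smul_sum, Function.comp_apply, Matrix.vecMul, dotProduct,
      Finset.sum_smul, smul_smul, Matrix.map_apply]
    exact Finset.sum_comm
  rw [h3]
  refine (he W hW).comp (Function.bijective_iff_has_inverse.2
    ⟨fun c => Matrix.vecMul c (Q.map (resO hW)), fun c => ?_, fun c => ?_⟩)
  · simp [Matrix.vecMul_vecMul, h1]
  · simp [Matrix.vecMul_vecMul, h2]

end IsFreeOn

/-! ### Germs, values at a point and bases of fibres. -/

lemma resO_germ {U W : X.Opens} (h : W ≤ U) {x : X} (hx : x ∈ W) (r : Γ(X, U)) :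
    X.presheaf.germ W x hx (resO h r) = X.presheaf.germ U x (h hx) r :=
  TopCat.Presheaf.germ_res_apply X.presheaf (homOfLE h) x hx r

lemma res_germ (M : X.Modules) {U W : X.Opens} (h : W ≤ U) {x : X} (hx : x ∈ W) (s : Γ(M, U)) :
    M.presheaf.germ W x hx (res M h s) = M.presheaf.germ U x (h hx) s :=
  TopCat.Presheaf.germ_res_apply M.presheaf (homOfLE h) x hx s

lemma mem_inf_finset_inf {ι : Type*} [Fintype ι] {U : X.Opens} {V : ι → X.Opens} {x : X}
    (hx : x ∈ U) (hV : ∀ i, x ∈ V i) : x ∈ U ⊓ Finset.univ.inf V := by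
  refine ⟨hx, ?_⟩
  rw [SetLike.mem_coe, ← SetLike.mem_coe, Opens.coe_finset_inf]
  simpa using hV

/-- Finitely many germs of functions are germs of functions on a common neighbourhood. -/
lemma exists_germ_eq_of_finite {ι : Type*} [Finite ι] {U : X.Opens} {x : X} (hx : x ∈ U)
    (g : ι → X.presheaf.stalk x) : ∃ (W : X.Opens) (_ : W ≤ U) (hxW : x ∈ W) (c : ι → Γ(X, W)),
      ∀ i, X.presheaf.germ W x hxW (c i) = g i := by
  cases nonempty_fintype ι
  choose V hV r hr using fun i => TopCat.Presheaf.exists_germ_eq X.presheaf (g i)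
  have hxW := mem_inf_finset_inf hx hV
  have hW (i) : U ⊓ Finset.univ.inf V ≤ V i := inf_le_right.trans (Finset.inf_le (Finset.mem_univ i))
  exact ⟨_, inf_le_left, hxW, fun i => resO (hW i) (r i), fun i => by rw [resO_germ, hr]⟩

/-- The value of a function at a point, in the residue field. -/
noncomputable def evalAt {U : X.Opens} {x : X} (hx : x ∈ U) :
    Γ(X, U) →+* IsLocalRing.ResidueField (X.presheaf.stalk x) :=
  (IsLocalRing.residue _).comp (X.presheaf.germ U x hx).hom

lemma evalAt_resO {U W : X.Opens} (h : W ≤ U) {x : X} (hx : x ∈ W) (r : Γ(X, U)) :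
    evalAt hx (resO h r) = evalAt (h hx) r :=
  congrArg (IsLocalRing.residue _) (resO_germ h hx r)

lemma exists_evalAt_eq_of_finite {ι : Type*} [Finite ι] {U : X.Opens} {x : X} (hx : x ∈ U)
    (g : ι → IsLocalRing.ResidueField (X.presheaf.stalk x)) :
    ∃ (W : X.Opens) (_ : W ≤ U) (hxW : x ∈ W) (c : ι → Γ(X, W)), ∀ i, evalAt hxW (c i) = g i := by
  choose g' hg' using fun i => IsLocalRing.residue_surjective (g i)
  obtain ⟨W, hW, hxW, c, hc⟩ := exists_germ_eq_of_finite hx g'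
  exact ⟨W, hW, hxW, c, fun i => by rw [← hg', ← hc]; rfl⟩

/-- A function with nonzero value at `x` is invertible near `x`. -/
lemma exists_isUnit_resO {U : X.Opens} {x : X} (hx : x ∈ U) (r : Γ(X, U)) (hr : evalAt hx r ≠ 0) :
    ∃ (W : X.Opens) (h : W ≤ U), x ∈ W ∧ IsUnit (resO h r) := by
  refine ⟨X.basicOpen r, X.basicOpen_le r, ?_, RingedSpace.isUnit_res_basicOpen _ r⟩
  rw [Scheme.mem_basicOpen _ _ _ hx]
  exact (IsLocalRing.residue_ne_zero_iff_isUnit _).1 hr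

/-- The value of a section at a point, in the fibre. -/
noncomputable def fiberVal (M : X.Modules) {U : X.Opens} {x : X} (hx : x ∈ U) :
    Γ(M, U) →+ Fiber M x where
  toFun s := 1 ⊗ₜ M.presheaf.germ U x hx s
  map_zero' := by simp
  map_add' s t := by simp [TensorProduct.tmul_add]

lemma fiberVal_smul (M : X.Modules) {U : X.Opens} {x : X} (hx : x ∈ U) (r : Γ(X, U)) (s : Γ(M, U)) :
    fiberVal M hx (r • s) = evalAt hx r • fiberVal M hx s := by
  change (1 : IsLocalRing.ResidueField (X.presheaf.stalk x)) ⊗ₜ M.presheaf.germ U x hx (r • s) =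
    evalAt hx r • (1 ⊗ₜ _)
  rw [germ_smul, TensorProduct.tmul_smul, TensorProduct.smul_tmul', TensorProduct.smul_tmul']
  rfl

lemma fiberVal_sum_smul (M : X.Modules) {U : X.Opens} {x : X} (hx : x ∈ U) {ι : Type*}
    (s : Finset ι) (c : ι → Γ(X, U)) (e : ι → Γ(M, U)) :
    fiberVal M hx (∑ i ∈ s, c i • e i) = ∑ i ∈ s, evalAt hx (c i) • fiberVal M hx (e i) := by
  rw [map_sum]
  exact Finset.sum_congr rfl fun i _ => fiberVal_smul M hx _ _

lemma fiberMap_fiberVal {M N : X.Modules} (φ : M ⟶ N) {U : X.Opens} {x : X} (hx : x ∈ U)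
    (s : Γ(M, U)) : fiberMap φ x (fiberVal M hx s) = fiberVal N hx (φ.app U s) := by
  change (stalkMap φ x).baseChange _ (1 ⊗ₜ _) = 1 ⊗ₜ _
  rw [LinearMap.baseChange_tmul]
  congr 1
  exact TopCat.Presheaf.stalkFunctor_map_germ_apply U x hx φ.mapPresheaf s

namespace IsFreeOn

variable {M : X.Modules} {U : X.Opens} {ι : Type*} [Fintype ι] {e : ι → Γ(M, U)}

/-- The germs of a frame form a basis of the stalk. -/
noncomputable def stalkBasis (he : IsFreeOn M e) {x : X} (hx : x ∈ U) :
    Module.Basis ι (X.presheaf.stalk x) (TopCat.Presheaf.stalk (C := Ab.{u}) M.presheaf x) :=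
  Module.Basis.mk (v := fun i => M.presheaf.germ U x hx (e i)) (by
    rw [Fintype.linearIndependent_iff]
    intro g hg
    obtain ⟨W, hW, hxW, c, hc⟩ := exists_germ_eq_of_finite hx g
    have h1 : M.presheaf.germ W x hxW (∑ i, c i • res M hW (e i)) = M.presheaf.germ W x hxW 0 := by
      rw [map_sum, map_zero, ← hg]
      refine Finset.sum_congr rfl fun i _ => ?_
      rw [germ_smul, hc, res_germ]
    obtain ⟨W', hxW', i1, i2, h2⟩ := TopCat.Presheaf.germ_eq M.presheaf x hxW hxW _ _ h1
    have h3 : res M i1.le (∑ i, c i • res M hW (e i)) = res M i2.le 0 := h2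
    rw [res_sum_smul, map_zero] at h3
    simp only [res_res] at h3
    have h4 : (fun i => resO i1.le (c i)) = 0 :=
      (he W' (i1.le.trans hW)).1 (by simpa using h3)
    intro i
    rw [← hc, ← resO_germ i1.le hxW', congr_fun h4 i]
    simp) (by
    rintro m -
    obtain ⟨W, hxW, s, rfl⟩ := TopCat.Presheaf.exists_germ_eq M.presheaf m
    obtain ⟨c, hc⟩ := (he (U ⊓ W) inf_le_left).2 (res M inf_le_right s)
    have hxUW : x ∈ U ⊓ W := ⟨hx, hxW⟩
    have h1 : M.presheaf.germ W x hxW s = M.presheaf.germ (U ⊓ W) x hxUW (res M inf_le_right s) :=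
      (res_germ M inf_le_right hxUW s).symm
    rw [h1, ← hc, map_sum]
    refine Submodule.sum_mem _ fun i _ => ?_
    rw [germ_smul, res_germ]
    exact Submodule.smul_mem _ _ (Submodule.subset_span ⟨i, rfl⟩))

/-- The values of a frame form a basis of the fibre. -/
noncomputable def fiberBasis (he : IsFreeOn M e) {x : X} (hx : x ∈ U) :
    Module.Basis ι (IsLocalRing.ResidueField (X.presheaf.stalk x)) (Fiber M x) :=
  (he.stalkBasis hx).baseChange _

lemma fiberBasis_apply (he : IsFreeOn M e) {x : X} (hx : x ∈ U) (i : ι) :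
    he.fiberBasis hx i = fiberVal M hx (e i) := by
  rw [fiberBasis, Module.Basis.baseChange_apply, stalkBasis, Module.Basis.mk_apply]
  rfl

lemma finrank_fiber (he : IsFreeOn M e) {x : X} (hx : x ∈ U) :
    Module.finrank (IsLocalRing.ResidueField (X.presheaf.stalk x)) (Fiber M x) = Fintype.card ι :=
  Module.finrank_eq_card_basis (he.fiberBasis hx)

end IsFreeOn

/-- The rank of a morphism at a point, in terms of its matrix with respect to frames. -/
lemma rankAt_eq_rank {M N : X.Modules} (φ : M ⟶ N) {U : X.Opens} {ι κ : Type*} [Fintype ι]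
    [Fintype κ] {e : ι → Γ(M, U)} {f : κ → Γ(N, U)} (he : IsFreeOn M e) (hf : IsFreeOn N f)
    (B : Matrix ι κ Γ(X, U)) (hB : ∀ i, φ.app U (e i) = ∑ j, B i j • f j) {x : X} (hx : x ∈ U) :
    rankAt φ x = (B.map (evalAt hx)).rank := by
  classical
  -- The transpose appears because the rows of `B` are indexed by the frame of the source.
  have h : LinearMap.toMatrix (he.fiberBasis hx) (hf.fiberBasis hx) (fiberMap φ x) =
      (B.map (evalAt hx)).transpose := by
    ext j i
    rw [LinearMap.toMatrix_apply, IsFreeOn.fiberBasis_apply, fiberMap_fiberVal, hB,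
      fiberVal_sum_smul]
    simp only [← hf.fiberBasis_apply, map_sum, map_smul]
    simp [Finsupp.single_apply]
  rw [← Matrix.rank_transpose, ← h, Matrix.rank_eq_finrank_range_toLin _ (hf.fiberBasis hx)
    (he.fiberBasis hx), Matrix.toLin_toMatrix]
  rfl

/-! ### Frames of `ℋom(M, L)`. -/

section Hom

variable {M N L : X.Modules} {U : X.Opens} {ι : Type*}

lemma homSubgroup.map_sum_smul (φ : homSubgroup M N U) {W : X.Opens} (hW : W ≤ U) (s : Finset ι)
    (c : ι → Γ(X, W)) (e : ι → Γ(M, W)) :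
    φ.1 ⟨W, hW⟩ (∑ i ∈ s, c i • e i) = ∑ i ∈ s, c i • φ.1 ⟨W, hW⟩ (e i) := by
  rw [map_sum]
  exact Finset.sum_congr rfl fun i _ => φ.2.1 W hW _ _

variable [Fintype ι]

lemma homSubgroup.ext_of_isFreeOn {e : ι → Γ(M, U)} (he : IsFreeOn M e) {φ ψ : homSubgroup M N U}
    (h : ∀ i, φ.1 ⟨U, le_rfl⟩ (e i) = ψ.1 ⟨U, le_rfl⟩ (e i)) : φ = ψ :=
  homSubgroup.ext fun W hW s => by
    obtain ⟨c, rfl⟩ := (he W hW).2 s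
    refine (homSubgroup.map_sum_smul φ hW _ c _).trans (Eq.trans (Finset.sum_congr rfl fun i _ => ?_)
      (homSubgroup.map_sum_smul ψ hW _ c _).symm)
    exact congrArg (c i • ·) ((φ.2.2 U W le_rfl hW _).trans ((congrArg (res N hW) (h i)).trans
      (ψ.2.2 U W le_rfl hW _).symm))

/-- The linear map `M|_U → N|_U` with prescribed values on a frame. -/
noncomputable def IsFreeOn.lift {e : ι → Γ(M, U)} (he : IsFreeOn M e) (t : ι → Γ(N, U)) :
    homSubgroup M N U :=
  ⟨fun W => (((he.restrict W.2).basis.constr Γ(X, W.1)) fun i => res N W.2 (t i)).toAddMonoidHom,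
    fun W hW r s => map_smul (((he.restrict hW).basis.constr Γ(X, W)) fun i => res N hW (t i)) r s,
    fun W W' hW h s => by
      have key (W : X.Opens) (hW : W ≤ U) (c : ι → Γ(X, W)) :
          (((he.restrict hW).basis.constr Γ(X, W)) fun i => res N hW (t i))
            (∑ i, c i • res M hW (e i)) = ∑ i, c i • res N hW (t i) := by
        rw [map_sum]
        refine Finset.sum_congr rfl fun i _ => ?_
        rw [map_smul]
        congr 1
        have := (he.restrict hW).basis.constr_basis Γ(X, W) (fun i => res N hW (t i)) i
        rwa [IsFreeOn.basis_apply] at this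
      obtain ⟨c, rfl⟩ := (he W hW).2 s
      refine (congrArg _ (res_sum_smul M h _ _ _)).trans ?_
      simp only [res_res]
      refine (key W' (h.trans hW) _).trans ?_
      refine Eq.trans ?_ (congrArg (res N h) (key W hW c)).symm
      rw [res_sum_smul]
      simp only [res_res]⟩

lemma IsFreeOn.lift_apply {e : ι → Γ(M, U)} (he : IsFreeOn M e) (t : ι → Γ(N, U)) (i : ι) :
    (he.lift t).1 ⟨U, le_rfl⟩ (e i) = t i := by
  have h := (he.restrict le_rfl).basis.constr_basis Γ(X, U) (fun i => res N le_rfl (t i)) i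
  rw [IsFreeOn.basis_apply, res_self, res_self] at h
  exact h

lemma IsFreeOn.evalHom_ext {e : ι → Γ(M, U)} (he : IsFreeOn M e) {φ ψ : Γ(sheafHom M L, U)}
    (h : ∀ i, evalHom φ (e i) = evalHom ψ (e i)) : φ = ψ :=
  homSubgroup.ext_of_isFreeOn he h

variable [DecidableEq ι]

/-- The frame of `ℋom(M, L)` dual to a frame of `M`, for a generator `l` of `L`. -/
noncomputable def IsFreeOn.dual {e : ι → Γ(M, U)} (he : IsFreeOn M e) (l : Γ(L, U)) (i : ι) :
    Γ(sheafHom M L, U) :=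
  he.lift (Pi.single i l : ι → Γ(L, U))

lemma evalHom_sum_smul {κ : Type*} (s : Finset κ) (c : κ → Γ(X, U)) (φ : κ → Γ(sheafHom M L, U))
    (m : Γ(M, U)) : evalHom (∑ i ∈ s, c i • φ i) m = ∑ i ∈ s, c i • evalHom (φ i) m := by
  let ev : Γ(sheafHom M L, U) →+ Γ(L, U) :=
    { toFun := fun φ => evalHom φ m
      map_zero' := rfl
      map_add' := fun _ _ => rfl }
  refine (map_sum ev _ s).trans (Finset.sum_congr rfl fun i _ => ?_)
  change resO le_rfl (c i) • evalHom (φ i) m = _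
  congr 1
  change (X.presheaf.map (𝟙 (op U))).hom (c i) = _
  rw [X.presheaf.map_id]; rfl

lemma evalHom_res {U W : X.Opens} (h : W ≤ U) (φ : Γ(sheafHom M L, U)) (m : Γ(M, U)) :
    evalHom (res (sheafHom M L) h φ) (res M h m) = res L h (evalHom φ m) :=
  (show homSubgroup M L U from φ).2.2 U W le_rfl h m

lemma IsFreeOn.evalHom_dual {e : ι → Γ(M, U)} (he : IsFreeOn M e) (l : Γ(L, U)) (i j : ι) :
    evalHom (he.dual l i) (e j) = if i = j then l else 0 := by
  refine (he.lift_apply _ j).trans ?_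
  simp [Pi.single_apply, eq_comm]

lemma IsFreeOn.eq_sum_dual {e : ι → Γ(M, U)} (he : IsFreeOn M e) (l : Γ(L, U))
    (φ : Γ(sheafHom M L, U)) (c : ι → Γ(X, U)) (hc : ∀ i, evalHom φ (e i) = c i • l) :
    φ = ∑ i, c i • he.dual l i := by
  refine he.evalHom_ext fun i => ?_
  rw [evalHom_sum_smul, hc]
  simp [he.evalHom_dual]

/-- Evaluation at `e j` reads off the `j`-th coefficient as a multiple of the generator of `L`. This
frame of the target of `λ` makes its matrix the array of values `λ(e i)(f j)`. -/
lemma IsFreeOn.isFreeOn_dual {e : ι → Γ(M, U)} (he : IsFreeOn M e) {l : Fin 1 → Γ(L, U)}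
    (hl : IsFreeOn L l) : IsFreeOn (sheafHom M L) (he.dual (l 0)) := by
  intro W hW
  have hl' : Function.Bijective fun c : Fin 1 → Γ(X, W) => c 0 • res L hW (l 0) := by
    simpa using hl W hW
  have hev (c : ι → Γ(X, W)) (j : ι) :
      evalHom (∑ i, c i • res (sheafHom M L) hW (he.dual (l 0) i)) (res M hW (e j)) =
        c j • res L hW (l 0) := by
    rw [evalHom_sum_smul]
    simp only [evalHom_res, he.evalHom_dual]
    rw [Finset.sum_eq_single j (fun i _ hij => by simp [hij]) (by simp)]
    simp
  constructor
  · intro c d hcd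
    funext j
    have h := congrArg (fun φ => evalHom φ (res M hW (e j))) hcd
    simp only [hev] at h
    exact congr_fun (hl'.1 (a₁ := fun _ => c j) (a₂ := fun _ => d j) h) 0
  · intro φ
    choose c hc using fun j => hl'.2 (evalHom φ (res M hW (e j)))
    refine ⟨fun j => c j 0, (he.restrict hW).evalHom_ext fun j => ?_⟩
    exact (hev (fun j => c j 0) j).trans (hc j)

end Hom

/-! ### Isomorphisms over an open subscheme. -/

section Restrict

variable {M N K : X.Modules} {U : X.Opens}

/-- The morphism `M|_U ⟶ N|_U` of modules on the scheme `U` given by a linear map. -/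
noncomputable def homSubgroup.toRestrict (φ : homSubgroup M N U) :
    M.restrict U.ι ⟶ N.restrict U.ι where
  val := PresheafOfModules.homMk
    { app W := AddCommGrpCat.ofHom (X := (M.restrict U.ι).presheaf.obj W)
        (Y := (N.restrict U.ι).presheaf.obj W)
        (φ.1 ⟨U.ι ''ᵁ W.unop, U.ι_image_le _⟩)
      naturality := by
        intro W W' i
        ext s
        exact φ.2.2 (U.ι ''ᵁ W.unop) (U.ι ''ᵁ W'.unop) _ (U.ι.image_mono i.unop.le) s }
    (fun W r s => φ.2.1 (U.ι ''ᵁ W.unop) _ _ s)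

/-- Mutually inverse linear maps give an isomorphism `M|_U ≅ N|_U`. -/
noncomputable def restrictIsoOfHomSubgroup (φ : homSubgroup M N U) (ψ : homSubgroup N M U)
    (h1 : ∀ W hW s, ψ.1 ⟨W, hW⟩ (φ.1 ⟨W, hW⟩ s) = s)
    (h2 : ∀ W hW s, φ.1 ⟨W, hW⟩ (ψ.1 ⟨W, hW⟩ s) = s) :
    M.restrict U.ι ≅ N.restrict U.ι where
  hom := homSubgroup.toRestrict φ
  inv := homSubgroup.toRestrict ψ
  hom_inv_id := by
    ext W s
    exact h1 _ _ s
  inv_hom_id := by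
    ext W s
    exact h2 _ _ s

/-- Frames with the same index set give an isomorphism `M|_U ≅ N|_U`. -/
noncomputable def IsFreeOn.restrictIso {ι : Type*} [Fintype ι] {e : ι → Γ(M, U)}
    {f : ι → Γ(N, U)} (he : IsFreeOn M e) (hf : IsFreeOn N f) :
    M.restrict U.ι ≅ N.restrict U.ι :=
  have key {M N : X.Modules} {e : ι → Γ(M, U)} {f : ι → Γ(N, U)} (he : IsFreeOn M e)
      (hf : IsFreeOn N f) (W : X.Opens) (hW : W ≤ U) (s : Γ(M, W)) :
      (hf.lift e).1 ⟨W, hW⟩ ((he.lift f).1 ⟨W, hW⟩ s) = s := by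
    obtain ⟨c, rfl⟩ := (he W hW).2 s
    refine (congrArg _ (homSubgroup.map_sum_smul (he.lift f) hW _ c _)).trans
      ((homSubgroup.map_sum_smul (hf.lift e) hW _ c _).trans (Finset.sum_congr rfl fun i _ => ?_))
    exact congrArg (c i • ·) ((congrArg _ (((he.lift f).2.2 U W le_rfl hW _).trans
      (congrArg (res N hW) (he.lift_apply f i)))).trans (((hf.lift e).2.2 U W le_rfl hW _).trans
      (congrArg (res M hW) (hf.lift_apply e i))))
  restrictIsoOfHomSubgroup (he.lift f) (hf.lift e) (key he hf) (key hf he)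

end Restrict

/-! ### Subbundles as local direct summands. -/

section Split

/-- A subbundle is locally a direct summand: a frame of it extends to a frame of the bundle. -/
lemma exists_isFreeOn_extend {M N : X.Modules} (φ : M ⟶ N) [Mono φ]
    (hφ : IsFiniteLocallyFree (Limits.cokernel φ)) {U : X.Opens} {ι : Type*} [Fintype ι]
    {e : ι → Γ(M, U)} (he : IsFreeOn M e) {x : X} (hx : x ∈ U) :
    ∃ (W : X.Opens) (h : W ≤ U) (_ : x ∈ W) (m : ℕ) (v : Fin m → Γ(N, W)),
      IsFreeOn N (Sum.elim (fun i => φ.app W (res M h (e i))) v) := by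
  obtain ⟨U', hxU', m, q, hq⟩ := hφ x
  let π := Limits.cokernel.π φ
  have hπφ (W : X.Opens) (s : Γ(M, W)) : π.app W (φ.app W s) = 0 := by
    have h : φ ≫ π = 0 := Limits.cokernel.condition φ
    have h' := congr(($h).app W s)
    exact h'
  -- The extra frame vectors are local lifts of a frame of the quotient.
  choose V hV s hxV hs using fun i => exists_local_lift_of_epi π (q i) hxU'
  let W : X.Opens := (U ⊓ U') ⊓ Finset.univ.inf V
  have hxW : x ∈ W := mem_inf_finset_inf ⟨hx, hxU'⟩ hxV
  have hWU : W ≤ U := inf_le_left.trans inf_le_left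
  have hWU' : W ≤ U' := inf_le_left.trans inf_le_right
  have hWV (i) : W ≤ V i := inf_le_right.trans (Finset.inf_le (Finset.mem_univ i))
  have hv (i) : π.app W (res N (hWV i) (s i)) = res _ hWU' (q i) := by
    rw [app_res, hs, res_res]
  refine ⟨W, hWU, hxW, m, fun i => res N (hWV i) (s i), fun W' hW' => ?_⟩
  have hsum (c : ι ⊕ Fin m → Γ(X, W')) :
      (∑ i, c i • res N hW' (Sum.elim (fun i => φ.app W (res M hWU (e i)))
        (fun i => res N (hWV i) (s i)) i)) =
      φ.app W' (∑ i, c (Sum.inl i) • res M (hW'.trans hWU) (e i)) +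
        ∑ i, c (Sum.inr i) • res N (hW'.trans (hWV i)) (s i) := by
    rw [Fintype.sum_sum_type, app_sum_smul]
    simp only [Sum.elim_inl, Sum.elim_inr, res_res, ← app_res]
  have hπ (c : ι ⊕ Fin m → Γ(X, W')) :
      π.app W' (φ.app W' (∑ i, c (Sum.inl i) • res M (hW'.trans hWU) (e i)) +
        ∑ i, c (Sum.inr i) • res N (hW'.trans (hWV i)) (s i)) =
      ∑ i, c (Sum.inr i) • res _ (hW'.trans hWU') (q i) := by
    rw [map_add, hπφ, zero_add, app_sum_smul]
    refine Finset.sum_congr rfl fun i _ => ?_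
    rw [← res_res N (hWV i) hW', app_res, hv, res_res]
  constructor
  · intro c d hcd
    simp only [hsum] at hcd
    have h1 := congrArg (π.app W') hcd
    rw [hπ, hπ] at h1
    have h2 : (fun i => c (Sum.inr i)) = fun i => d (Sum.inr i) := (hq W' (hW'.trans hWU')).1 h1
    have h3 (i) : c (Sum.inr i) = d (Sum.inr i) := congr_fun h2 i
    simp only [h3] at hcd
    have h4 := app_injective_of_mono φ W' (add_right_cancel hcd)
    have h5 : (fun i => c (Sum.inl i)) = fun i => d (Sum.inl i) := (he W' (hW'.trans hWU)).1 h4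
    funext i
    rcases i with i | i
    · exact congr_fun h5 i
    · exact h3 i
  · intro t
    obtain ⟨d, hd⟩ := (hq W' (hW'.trans hWU')).2 (π.app W' t)
    have h1 : π.app W' (t - ∑ i, d i • res N (hW'.trans (hWV i)) (s i)) = 0 := by
      have h2 := hπ (Sum.elim 0 d)
      simp only [Sum.elim_inl, Sum.elim_inr, Pi.zero_apply, zero_smul, Finset.sum_const_zero,
        map_zero, zero_add] at h2
      rw [map_sub, h2, ← hd, sub_self]
    obtain ⟨r, hr⟩ := exists_app_eq_of_cokernel_eq_zero φ _ h1
    obtain ⟨c, rfl⟩ := (he W' (hW'.trans hWU)).2 r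
    refine ⟨Sum.elim c d, ?_⟩
    simp only [hsum]
    simp only [Sum.elim_inl, Sum.elim_inr]
    simp only at hr
    rw [hr, sub_add_cancel]

/-- The inclusion of a subbundle is injective on fibres. -/
lemma fiberMap_injective {M N : X.Modules} (φ : M ⟶ N) [Mono φ]
    (hφ : IsFiniteLocallyFree (Limits.cokernel φ)) {n : ℕ} (hM : IsVectorBundle M n) (x : X) :
    Function.Injective (fiberMap φ x) := by
  obtain ⟨U, hxU, e, he⟩ := hM x
  have he : IsFreeOn M e := he
  -- Fibres do not preserve monomorphisms in general; here the values of a frame of `M` are part of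
  -- a basis of the fibre of `N`.
  obtain ⟨W, hWU, hxW, m, v, hv⟩ := exists_isFreeOn_extend φ hφ he hxU
  have h := (hv.fiberBasis hxW).linearIndependent.comp Sum.inl Sum.inl_injective
  refine LinearMap.injective_of_linearIndependent ((he.restrict hWU).fiberBasis hxW).span_eq ?_
  have heq : fiberMap φ x ∘ (he.restrict hWU).fiberBasis hxW = hv.fiberBasis hxW ∘ Sum.inl := by
    funext i
    simp [IsFreeOn.fiberBasis_apply, fiberMap_fiberVal]
  rw [heq]
  exact h

end Split

/-- This transfers the alternating property from a matrix `Z` in frames to all sections over smaller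
open sets. -/
lemma evalHom_app_sum_smul {M N L : X.Modules} (φ : M ⟶ sheafHom N L) {U : X.Opens}
    {ι κ : Type*} [Fintype ι] [Fintype κ] {e : ι → Γ(M, U)} {f : κ → Γ(N, U)} {l : Γ(L, U)}
    {Z : Matrix ι κ Γ(X, U)} (hZ : ∀ i j, evalHom (φ.app U (e i)) (f j) = Z i j • l)
    {W : X.Opens} (hW : W ≤ U) (c : ι → Γ(X, W)) (d : κ → Γ(X, W)) :
    evalHom (φ.app W (∑ i, c i • res M hW (e i))) (∑ j, d j • res N hW (f j)) =
      (∑ i, ∑ j, c i * Z.map (resO hW) i j * d j) • res L hW l := by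
  rw [app_sum_smul, evalHom_sum_smul, Finset.sum_smul]
  refine Finset.sum_congr rfl fun i _ => ?_
  have h1 : evalHom (φ.app W (res M hW (e i))) (∑ j, d j • res N hW (f j)) =
      ∑ j, d j • evalHom (φ.app W (res M hW (e i))) (res N hW (f j)) :=
    homSubgroup.map_sum_smul _ le_rfl _ _ _
  rw [h1, Finset.smul_sum, Finset.sum_smul]
  refine Finset.sum_congr rfl fun j _ => ?_
  rw [app_res, evalHom_res, hZ, res_smul, smul_smul, smul_smul, Matrix.map_apply]
  congr 1
  ring

lemma fiberMap_comp {M N K : X.Modules} (φ : M ⟶ N) (ψ : N ⟶ K) {n : ℕ} (hM : IsVectorBundle M n)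
    (x : X) : fiberMap (φ ≫ ψ) x = fiberMap ψ x ∘ₗ fiberMap φ x := by
  obtain ⟨U, hxU, e, he⟩ := hM x
  have he : IsFreeOn M e := he
  refine (he.fiberBasis hxU).ext fun i => ?_
  rw [LinearMap.comp_apply, he.fiberBasis_apply, fiberMap_fiberVal, fiberMap_fiberVal,
    fiberMap_fiberVal]
  rfl

lemma exists_image_ι_eq {U W : X.Opens} (hW : W ≤ U) : ∃ W' : (U : Scheme.{u}).Opens,
    U.ι ''ᵁ W' = W :=
  ⟨U.ι ⁻¹ᵁ W, by
    rw [Scheme.Hom.image_preimage_eq_opensRange_inf, Scheme.Opens.opensRange_ι]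
    exact inf_eq_right.2 hW⟩

/-- An isomorphism `M|_U ≅ N|_U` takes frames to frames. -/
lemma IsFreeOn.map_restrictIso {M N : X.Modules} {U : X.Opens}
    (i : M.restrict U.ι ≅ N.restrict U.ι) {W : (U : Scheme.{u}).Opens} {ι : Type*} [Fintype ι]
    {e : ι → Γ(M, U.ι ''ᵁ W)} (he : IsFreeOn M e) :
    IsFreeOn N (U := U.ι ''ᵁ W) fun k => i.hom.app W (e k) := by
  intro V hV
  obtain ⟨V, rfl⟩ := exists_image_ι_eq (hV.trans (U.ι_image_le W))
  have hVW : V ≤ W := by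
    intro y hy
    obtain ⟨z, hz, hzy⟩ := hV (⟨y, hy, rfl⟩ : U.ι y ∈ U.ι ''ᵁ V)
    rwa [← U.ι.isOpenEmbedding.injective hzy]
  let j : Γ(M, U.ι ''ᵁ V) →+ Γ(N, U.ι ''ᵁ V) := (i.hom.app V).hom
  have hj : Function.Bijective j :=
    (ConcreteCategory.isIso_iff_bijective (i.hom.app V)).1 inferInstance
  -- Linearity of `i` is over the structure sheaf of the scheme `U`; `appIso` carries it over to
  -- functions on open subsets of `X`.
  have hsmul (r : Γ(X, U.ι ''ᵁ V)) (s : Γ(M, U.ι ''ᵁ V)) : j (r • s) = r • j s := by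
    have h := i.hom.app_smul (U := V) ((U.ι.appIso V).hom r) s
    have h' : j ((U.ι.appIso V).inv ((U.ι.appIso V).hom r) • s) =
      (U.ι.appIso V).inv ((U.ι.appIso V).hom r) • j s := h
    have h2 : (U.ι.appIso V).inv ((U.ι.appIso V).hom r) = r :=
      congr($((U.ι.appIso V).hom_inv_id) r)
    rwa [h2] at h'
  have hres (k) : j (res M hV (e k)) = res N hV (i.hom.app W (e k) : Γ(N, U.ι ''ᵁ W)) :=
    app_res i.hom hVW (e k)
  have h : (fun c : ι → Γ(X, U.ι ''ᵁ V) =>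
      ∑ k, c k • res N hV (i.hom.app W (e k) : Γ(N, U.ι ''ᵁ W))) =
      j ∘ fun c => ∑ k, c k • res M hV (e k) := by
    funext c
    simp only [Function.comp_apply, map_sum, hsmul, hres]
  rw [h]
  exact hj.comp (he _ hV)

/-! ### The comparison map on fibres and in frames. -/

namespace LagrangianSubbundle

variable {B : TwistedOrthogonalBundle X} (E F : LagrangianSubbundle B)

lemma rank_eq : E.rank = F.rank := by
  have h1 := E.two_mul_rank
  have h2 := F.two_mul_rank
  omega

lemma evalHom_comparison {U : X.Opens} (s : Γ(E.E, U)) (t : Γ(F.E, U)) :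
    evalHom ((E.comparison F).app U s) t =
      QuadraticMap.polar (B.q.app U) (E.incl.app U s) (F.incl.app U t) := by
  change QuadraticMap.polar (B.q.app U) (res B.V le_rfl (E.incl.app U s)) (F.incl.app U t) = _
  rw [res_self]

lemma polar_incl {U : X.Opens} (s t : Γ(E.E, U)) :
    QuadraticMap.polar (B.q.app U) (E.incl.app U s) (E.incl.app U t) = 0 := by
  rw [QuadraticMap.polar, ← map_add, E.isotropic, E.isotropic, E.isotropic]
  simp

/-- Local frames of a Lagrangian subbundle and of the line bundle, together with dual sections. -/
lemma exists_frame_dual {U : X.Opens} {x : X} (hx : x ∈ U) :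
    ∃ (W : X.Opens) (_ : W ≤ U) (_ : x ∈ W) (f : Fin F.rank → Γ(F.E, W)) (l : Fin 1 → Γ(B.L, W))
      (c : Fin F.rank → Γ(B.V, W)), IsFreeOn F.E f ∧ IsFreeOn B.L l ∧
      ∀ i j, QuadraticMap.polar (B.q.app W) (c i) (F.incl.app W (f j)) =
        if i = j then l 0 else 0 := by
  obtain ⟨U1, hxU1, f, hf⟩ := F.isVectorBundle x
  obtain ⟨U2, hxU2, l, hl⟩ := B.isLineBundle x
  have hf : IsFreeOn F.E f := hf
  have hl : IsFreeOn B.L l := hl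
  have := F.mono
  have h1 : U ⊓ U1 ⊓ U2 ≤ U1 := inf_le_left.trans inf_le_right
  obtain ⟨W, hW, hxW, m, v, hv⟩ := exists_isFreeOn_extend F.incl F.quotient_locallyFree
    (hf.restrict h1) (x := x) ⟨⟨hx, hxU1⟩, hxU2⟩
  have := B.nonsingular
  have hiso : Function.Bijective (B.q.polarHom.app W) :=
    (ConcreteCategory.isIso_iff_bijective _).1 inferInstance
  have hl' := hl.restrict (hW.trans inf_le_right)
  -- The `ψ i` are the coordinate functionals, times `l`, on the frame of `V` extending that of `F`;
  -- perfectness of the pairing represents them by sections `c i`.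
  let ψ (i : Fin F.rank) : Γ(sheafHom B.V B.L, W) :=
    hv.dual (res B.L (hW.trans inf_le_right) (l 0)) (Sum.inl i)
  choose c hc using fun i => hiso.2 (ψ i)
  refine ⟨W, hW.trans (inf_le_left.trans inf_le_left), hxW, _, _, c,
    (hf.restrict h1).restrict hW, hl', fun i j => ?_⟩
  have h2 : evalHom (B.q.polarHom.app W (c i)) (F.incl.app W (res F.E hW (res F.E h1 (f j)))) =
      if i = j then res B.L (hW.trans inf_le_right) (l 0) else 0 := by
    rw [hc]
    refine (hv.evalHom_dual _ (Sum.inl i) (Sum.inl j)).trans ?_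
    simp
  rw [← h2]
  change _ = QuadraticMap.polar (B.q.app W) (res B.V le_rfl (c i)) _
  rw [res_self]

/-- The dimension of `E(x) ∩ F(x)` and the rank of `λ(x)` add up to the rank of `E`. -/
lemma finrank_fiberInter_add_rankAt (x : X) :
    Module.finrank (IsLocalRing.ResidueField (X.presheaf.stalk x)) (E.fiberInter F x) +
      rankAt (E.comparison F) x = E.rank := by
  let μ : B.V ⟶ sheafHom F.E B.L := B.q.polarHom ≫ sheafHomPrecomp F.incl B.L
  have hμ {U : X.Opens} (v : Γ(B.V, U)) (t : Γ(F.E, U)) :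
      evalHom (μ.app U v) t = QuadraticMap.polar (B.q.app U) v (F.incl.app U t) := by
    change QuadraticMap.polar (B.q.app U) (res B.V le_rfl v) (F.incl.app U t) = _
    rw [res_self]
  have := E.mono
  have := F.mono
  have hEinj := fiberMap_injective E.incl E.quotient_locallyFree E.isVectorBundle x
  have hFinj := fiberMap_injective F.incl F.quotient_locallyFree F.isVectorBundle x
  obtain ⟨UE, hxUE, e, he⟩ := E.isVectorBundle x
  obtain ⟨UV, hxUV, v, hv⟩ := B.isVectorBundle x
  have he : IsFreeOn E.E e := he
  have hv : IsFreeOn B.V v := hv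
  obtain ⟨W, -, hxW, f, l, c, hf, hl, hc⟩ := F.exists_frame_dual (U := ⊤) (x := x) trivial
  have hEfin := he.finrank_fiber hxUE
  have hVfin := hv.finrank_fiber hxUV
  have hFfin := hf.finrank_fiber hxW
  have hdual := hf.isFreeOn_dual hl
  have hHfin := hdual.finrank_fiber hxW
  rw [Fintype.card_fin] at hEfin hVfin hFfin hHfin
  have : Module.Finite (IsLocalRing.ResidueField (X.presheaf.stalk x)) (Fiber B.V x) :=
    Module.Finite.of_basis (hv.fiberBasis hxUV)
  have : Module.Finite (IsLocalRing.ResidueField (X.presheaf.stalk x)) (Fiber E.E x) :=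
    Module.Finite.of_basis (he.fiberBasis hxUE)
  -- The dual sections `c i` map to the dual frame of `F^*(L)`.
  have hsurj : LinearMap.range (fiberMap μ x) = ⊤ := by
    rw [eq_top_iff, ← (hdual.fiberBasis hxW).span_eq, Submodule.span_le]
    rintro _ ⟨i, rfl⟩
    refine ⟨fiberVal B.V hxW (c i), ?_⟩
    rw [fiberMap_fiberVal, hdual.fiberBasis_apply]
    congr 1
    refine hf.evalHom_ext fun j => ?_
    rw [hμ, hc, hf.evalHom_dual]
  have hle : LinearMap.range (fiberMap F.incl x) ≤ LinearMap.ker (fiberMap μ x) := by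
    rw [LinearMap.range_eq_map, ← (hf.fiberBasis hxW).span_eq, Submodule.map_span, Submodule.span_le]
    rintro _ ⟨_, ⟨i, rfl⟩, rfl⟩
    rw [SetLike.mem_coe, LinearMap.mem_ker, hf.fiberBasis_apply, fiberMap_fiberVal,
      fiberMap_fiberVal]
    rw [show μ.app W (F.incl.app W (f i)) = 0 from hf.evalHom_ext fun j => by
      rw [hμ, polar_incl]; rfl, map_zero]
  -- Both sides have dimension `n`: the kernel by rank-nullity, the image of `F(x)` by injectivity
  -- on fibres.
  have hker : LinearMap.range (fiberMap F.incl x) = LinearMap.ker (fiberMap μ x) := by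
    refine Submodule.eq_of_le_of_finrank_eq hle ?_
    have h1 := LinearMap.finrank_range_add_finrank_ker (fiberMap μ x)
    rw [hsurj, finrank_top, hHfin, hVfin] at h1
    have h2 := LinearMap.finrank_range_of_inj hFinj
    have h3 := F.two_mul_rank
    omega
  have hcomp : fiberMap (E.comparison F) x = fiberMap μ x ∘ₗ fiberMap E.incl x :=
    fiberMap_comp E.incl μ E.isVectorBundle x
  have h1 := LinearMap.finrank_range_add_finrank_ker (fiberMap (E.comparison F) x)
  have h2 : LinearMap.ker (fiberMap (E.comparison F) x) =
      (LinearMap.range (fiberMap F.incl x)).comap (fiberMap E.incl x) := by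
    rw [hcomp, LinearMap.ker_comp, hker]
  have h3 : E.fiberInter F x =
      (LinearMap.ker (fiberMap (E.comparison F) x)).map (fiberMap E.incl x) := by
    rw [h2, Submodule.map_comap_eq, fiberInter]
  have h4 := (Submodule.equivMapOfInjective (fiberMap E.incl x) hEinj
    (LinearMap.ker (fiberMap (E.comparison F) x))).finrank_eq
  rw [h3, ← h4, rankAt, add_comm, h1, hEfin]

/-- The matrix of the comparison map, for frames of the three bundles. -/
lemma comparison_app_eq_sum {U : X.Opens} {ι κ : Type*} [Fintype κ] [DecidableEq κ]
    {e : ι → Γ(E.E, U)} {f : κ → Γ(F.E, U)} (hf : IsFreeOn F.E f) {l : Γ(B.L, U)}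
    {Z : Matrix ι κ Γ(X, U)} (hZ : ∀ i j, evalHom ((E.comparison F).app U (e i)) (f j) = Z i j • l)
    (i : ι) : (E.comparison F).app U (e i) = ∑ j, Z i j • hf.dual l j :=
  hf.eq_sum_dual l _ _ (hZ i)

end LagrangianSubbundle

lemma IsFreeOn.coord_smul {L : X.Modules} {U : X.Opens} {l : Fin 1 → Γ(L, U)} (hl : IsFreeOn L l)
    (s : Γ(L, U)) : hl.basis.coord 0 s • l 0 = s := by
  simpa using hl.sum_repr s

lemma IsFreeOn.coord_self {L : X.Modules} {U : X.Opens} {l : Fin 1 → Γ(L, U)}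
    (hl : IsFreeOn L l) : hl.basis.coord 0 (l 0) = 1 := by
  rw [← hl.basis_apply 0]
  simp

/-! ### Even rank and local alternation. -/

namespace LagrangianSubbundle

variable {B : TwistedOrthogonalBundle X} (E F : LagrangianSubbundle B)

/-- The rank of a locally alternating comparison map is even. -/
lemma even_rankAt_of_isLocallyAlternating (h : IsLocallyAlternating (E.comparison F)) (x : X) :
    Even (rankAt (E.comparison F) x) := by
  obtain ⟨U, hxU, i, hi⟩ := h x
  obtain ⟨W1, hW1, hxW1, f1, l1, -, hf1, hl1, -⟩ := F.exists_frame_dual hxU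
  obtain ⟨W, rfl⟩ := exists_image_ι_eq hW1
  let e (k : Fin F.rank) : Γ(E.E, U.ι ''ᵁ W) := i.hom.app W (f1 k)
  have he : IsFreeOn E.E e := hf1.map_restrictIso i
  -- `Λ` is the alternating form `ζ(s)(t)`; polarizing `Λ s s = 0` makes its matrix skew, and the
  -- diagonal vanishes by hypothesis.
  let Λ (s t : Γ(F.E, U.ι ''ᵁ W)) : Γ(B.L, U.ι ''ᵁ W) :=
    QuadraticMap.polar (B.q.app _) (E.incl.app (U.ι ''ᵁ W) (i.hom.app W s))
      (F.incl.app (U.ι ''ᵁ W) t)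
  have hΛ (s) : Λ s s = 0 := (E.evalHom_comparison F _ s).symm.trans (hi W s)
  have hadd1 (s s' t) : Λ (s + s') t = Λ s t + Λ s' t := by
    have h1 : E.incl.app (U.ι ''ᵁ W) (i.hom.app W (s + s')) =
        E.incl.app (U.ι ''ᵁ W) (i.hom.app W s) + E.incl.app (U.ι ''ᵁ W) (i.hom.app W s') :=
      (congrArg _ (map_add (i.hom.app W).hom s s')).trans (map_add (E.incl.app (U.ι ''ᵁ W)).hom _ _)
    simp only [Λ]
    rw [h1, QuadraticMap.polar_add_left]
  have hadd2 (s t t') : Λ s (t + t') = Λ s t + Λ s t' := by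
    simp only [Λ]
    rw [map_add, QuadraticMap.polar_add_right]
  have hskew (s t) : Λ s t = -Λ t s := by
    have h := hΛ (s + t)
    rw [hadd1, hadd2, hadd2, hΛ, hΛ, zero_add, add_zero] at h
    exact eq_neg_of_add_eq_zero_left h
  let Z : Matrix (Fin F.rank) (Fin F.rank) Γ(X, U.ι ''ᵁ W) :=
    Matrix.of fun j k => hl1.basis.coord 0 (Λ (f1 j) (f1 k))
  have hZ : Z.IsAlternating :=
    ⟨fun j => by simp only [Z, Matrix.of_apply, hΛ, map_zero], fun j k => by
      simp only [Z, Matrix.of_apply]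
      rw [hskew, map_neg]⟩
  have hZ' (j k) : evalHom ((E.comparison F).app _ (e j)) (f1 k) = Z j k • l1 0 := by
    rw [evalHom_comparison]
    exact (hl1.coord_smul _).symm
  rw [rankAt_eq_rank _ he (hf1.isFreeOn_dual hl1) Z (E.comparison_app_eq_sum F hf1 hZ') hxW1]
  exact (hZ.map _).even_rank

/-- If the comparison map has even rank at a point, then it is alternating near this point, for a
suitable identification of the two bundles. -/
lemma exists_isAlternatingOn_of_even_rankAt (x : X) (hx : Even (rankAt (E.comparison F) x)) :
    ∃ U : X.Opens, x ∈ U ∧ ∃ i : F.E.restrict U.ι ≅ E.E.restrict U.ι,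
      IsAlternatingOn U (i.hom ≫ (Scheme.Modules.restrictFunctor U.ι).map (E.comparison F)) := by
  have := E.mono
  obtain ⟨UE, hxUE, e0, he0⟩ := E.rank_eq F ▸ E.isVectorBundle x
  obtain ⟨UV, hxUV, v0, hv0⟩ := B.isVectorBundle x
  obtain ⟨W, hW, hxW, f, l, c, hf, hl, hc⟩ := F.exists_frame_dual (U := UE ⊓ UV) (x := x)
    ⟨hxUE, hxUV⟩
  have hv := IsFreeOn.restrict (show IsFreeOn B.V v0 from hv0) (hW.trans inf_le_right)
  have he := IsFreeOn.restrict (show IsFreeOn E.E e0 from he0) (hW.trans inf_le_left)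
  set e : Fin F.rank → Γ(E.E, W) := fun i => res E.E (hW.trans inf_le_left) (e0 i)
  -- The generator of `L` turns `q` into a scalar-valued form.
  let Q : QuadraticForm Γ(X, W) Γ(B.V, W) := (hl.basis.coord 0).compQuadraticMap (B.q.app W)
  have hQ (v w) : QuadraticMap.polar Q v w =
      hl.basis.coord 0 (QuadraticMap.polar (B.q.app W) v w) := by
    simp [Q, QuadraticMap.polar, -Module.Basis.coord_apply]
  have hQE (G : LagrangianSubbundle B) (s) : Q (G.incl.app W s) = 0 := by
    simp only [Q, LinearMap.compQuadraticMap_apply, G.isotropic, map_zero]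
  obtain ⟨c', A, hexp, hAB⟩ := Q.exists_coordinates_of_isotropic hv.basis
    (f := fun j => F.incl.app W (f j)) (c := c) (e := fun j => E.incl.app W (e j))
    (by rw [Fintype.card_fin, F.two_mul_rank]) (fun j => hQE F _)
    (fun j k => by rw [hQ, polar_incl, map_zero])
    (fun j k => by
      rw [hQ, hc]
      split_ifs
      · exact hl.coord_self
      · exact map_zero _)
    (fun j => hQE E _) (fun j k => by rw [hQ, polar_incl, map_zero])
  set M : Matrix (Fin F.rank) (Fin F.rank) Γ(X, W) :=
    Matrix.of fun j k => QuadraticMap.polar Q (E.incl.app W (e j)) (F.incl.app W (f k)) with hM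
  have hMl (j k) : evalHom ((E.comparison F).app W (e j)) (f k) = M j k • l 0 := by
    rw [evalHom_comparison, hM, Matrix.of_apply, hQ, hl.coord_smul]
  have hrank := rankAt_eq_rank _ he (hf.isFreeOn_dual hl) M (E.comparison_app_eq_sum F hf hMl) hxW
  rw [hrank] at hx
  obtain ⟨S0, hS0, hdet⟩ := Matrix.exists_isAlternating_det_sub_mul_ne_zero
    (A := A.map (evalAt hxW)) (B := M.map (evalAt hxW))
    (by rw [← Matrix.transpose_map, ← Matrix.map_mul]; exact hAB.map _)
    (by
      intro u hu1 hu2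
      -- A row relation `u` of `(A | M)` at `x` is a combination of the `e j` whose image in `V(x)`
      -- is zero; injectivity on fibres forces `u = 0`.
      have h1 : fiberMap E.incl x (∑ j, u j • fiberVal E.E hxW (e j)) = 0 := by
        have h2 (j) : fiberVal B.V hxW (E.incl.app W (e j)) =
            ∑ k, A.map (evalAt hxW) j k • fiberVal B.V hxW (F.incl.app W (f k)) +
              ∑ k, M.map (evalAt hxW) j k • fiberVal B.V hxW (c' k) := by
          conv_lhs => rw [hexp j]
          rw [map_add, fiberVal_sum_smul, fiberVal_sum_smul]
          rfl
        have h3 (D : Matrix (Fin F.rank) (Fin F.rank)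
            (IsLocalRing.ResidueField (X.presheaf.stalk x))) (hD : Matrix.vecMul u D = 0)
            (w : Fin F.rank → Fiber B.V x) : ∑ j, u j • ∑ k, D j k • w k = 0 := by
          simp only [Finset.smul_sum, smul_smul]
          rw [Finset.sum_comm]
          refine Finset.sum_eq_zero fun k _ => ?_
          rw [← Finset.sum_smul, show ∑ j, u j * D j k = 0 from congr_fun hD k, zero_smul]
        simp only [map_sum, map_smul, fiberMap_fiberVal, h2, smul_add, Finset.sum_add_distrib]
        rw [h3 _ hu1, h3 _ hu2, add_zero]
      have h4 := fiberMap_injective E.incl E.quotient_locallyFree E.isVectorBundle x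
        (h1.trans (map_zero _).symm)
      funext j
      refine Fintype.linearIndependent_iff.1 (he.fiberBasis hxW).linearIndependent u ?_ j
      simpa only [he.fiberBasis_apply] using h4)
    hx
  obtain ⟨W3, hW3, hxW3, s, hs⟩ := exists_evalAt_eq_of_finite hxW
    fun p : Fin F.rank × Fin F.rank => S0 p.1 p.2
  -- Only the entries above the diagonal are lifted, so that `S` is alternating on a neighbourhood
  -- and not merely at `x`.
  let S : Matrix (Fin F.rank) (Fin F.rank) Γ(X, W3) := Matrix.of fun j k =>
    if j < k then s (j, k) else if k < j then -s (k, j) else 0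
  have hS : S.IsAlternating := by
    constructor
    · intro j; simp [S]
    · intro j k
      rcases lt_trichotomy j k with h | rfl | h
      · simp [S, h, h.not_gt]
      · simp [S]
      · simp [S, h, h.not_gt]
  have hSS0 : S.map (evalAt hxW3) = S0 := by
    ext j k
    rcases lt_trichotomy j k with h | rfl | h
    · simp [S, h, hs]
    · simp [S, hS0.diag]
    · simp [S, h, h.not_gt, hs, ← hS0.skew j k]
  let D : Matrix (Fin F.rank) (Fin F.rank) Γ(X, W3) := A.map (resO hW3) - M.map (resO hW3) * S
  have hD : evalAt hxW3 D.det ≠ 0 := by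
    have h : D.map (evalAt hxW3) = A.map (evalAt hxW) - M.map (evalAt hxW) * S0 := by
      ext j k
      simp [D, ← hSS0, Matrix.mul_apply, evalAt_resO]
    rw [RingHom.map_det]
    change (D.map (evalAt hxW3)).det ≠ 0
    rwa [h]
  obtain ⟨W4, hW4, hxW4, hu⟩ := exists_isUnit_resO hxW3 _ hD
  have hWW := hW4.trans hW3
  let A4 := A.map (resO hWW)
  let M4 := M.map (resO hWW)
  let S4 := S.map (resO hW4)
  have hD4 : D.map (resO hW4) = A4 - M4 * S4 := by
    ext j k
    simp [D, A4, M4, S4, Matrix.mul_apply, resO_resO]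
  rw [RingHom.map_det] at hu
  change IsUnit (D.map (resO hW4)).det at hu
  rw [hD4] at hu
  let P := (A4 - M4 * S4)⁻¹
  have hP : P * (A4 - M4 * S4) = 1 := Matrix.nonsing_inv_mul _ hu
  have hPM : (P * M4).IsAlternating := by
    refine Matrix.IsAlternating.mul_of_mul_sub_eq_one ?_ (hS.map (resO hW4)) hP
    rw [← Matrix.transpose_map, ← Matrix.map_mul]
    exact hAB.map _
  have hf4 := hf.restrict hWW
  -- In the frame `P e` of `E` the matrix of `λ` is `P M`, so the isomorphism `f k ↦ (P e) k` is the
  -- one sought.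
  have he4 := (he.restrict hWW).matrix_mul hP
  have hZ (j k) : evalHom ((E.comparison F).app W4 (∑ i, P j i • res E.E hWW (e i)))
      (res F.E hWW (f k)) = (P * M4) j k • res B.L hWW (l 0) := by
    rw [app_sum_smul, evalHom_sum_smul, Matrix.mul_apply, Finset.sum_smul]
    refine Finset.sum_congr rfl fun i _ => ?_
    rw [app_res, evalHom_res, hMl, res_smul, smul_smul]
    rfl
  refine ⟨W4, hxW4, hf4.restrictIso he4, fun W' t => ?_⟩
  obtain ⟨d, hd⟩ := (hf4 (W4.ι ''ᵁ W') (W4.ι_image_le W')).2 t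
  have h1 : (hf4.lift fun i => ∑ j, P i j • res E.E hWW (e j)).1 ⟨W4.ι ''ᵁ W', W4.ι_image_le W'⟩ t =
      ∑ i, d i • res E.E (W4.ι_image_le W') (∑ j, P i j • res E.E hWW (e j)) := by
    rw [← hd]
    refine (homSubgroup.map_sum_smul _ (W4.ι_image_le W') _ d _).trans ?_
    refine Finset.sum_congr rfl fun i _ => congrArg (d i • ·) ?_
    refine ((hf4.lift _).2.2 W4 (W4.ι ''ᵁ W') le_rfl (W4.ι_image_le W') _).trans
      (congrArg _ (hf4.lift_apply _ i))
  have h2 := evalHom_app_sum_smul (E.comparison F) hZ (W4.ι_image_le W') d d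
  rw [(hPM.map _).sum_eq_zero, zero_smul] at h2
  refine Eq.trans ?_ h2
  exact congrArg₂ (fun a b => evalHom ((E.comparison F).app (W4.ι ''ᵁ W') a) b) h1 hd.symm

end LagrangianSubbundle

end SheafModules

theorem mainTheorem8 {X : AlgebraicGeometry.Scheme.{u}}
    (B : SheafModules.TwistedOrthogonalBundle X) (E F : SheafModules.LagrangianSubbundle B) :
    List.TFAE [
      ∀ x : X, Even (SheafModules.rankAt (E.comparison F) x),
      ∀ x : X, Module.finrank (IsLocalRing.ResidueField (X.presheaf.stalk x))
        (E.fiberInter F x) ≡ E.rank [MOD 2],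
      SheafModules.IsLocallyAlternating (E.comparison F)] := by
  tfae_have 1 ↔ 2 := by
    refine forall_congr' fun x => ?_
    have h := E.finrank_fiberInter_add_rankAt F x
    rw [Nat.even_iff, Nat.ModEq]
    omega
  tfae_have 3 → 1 := E.even_rankAt_of_isLocallyAlternating F
  tfae_have 1 → 3 := fun h x => E.exists_isAlternatingOn_of_even_rankAt F x (h x)
  tfae_finish
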